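/- Let $B=\{B_t\}_{t\ge 0}$ be a one-dimensional fractional Brownian motion with Hurst parameter $H$ on a probability space $(\Omega,\mathcal F,\mathbb P)$, i.e. a centered Gaussian process with $\mathbb E[B_tB_s]=\frac12(t^{2H}+s^{2H}-|t-s|^{2H})$. Let $\mathfrak H$ be the completion of the step functions on $[0,\infty)$ under $\langle \mathbf 1_{[a,b]},\mathbf 1_{[c,d]}\rangle_{\mathfrak H}=\mathbb E[(B_b-B_a)(B_d-B_c)]$, let $h\mapsto B(h)$ be the linear isometry $\mathfrak H\to L^2(\Omega)$ extending $\mathbf 1_{[0,t]}\mapsto B_t$, let $H_m$ denote the $m$-th (monic) Hermite polynomial, and let $I_m$ be the multiple integral, i.e. the linear isometry from the symmetric tensor power $\mathfrak H^{\odot m}$ (with norm $\sqrt{m!}\,\|\cdot\|_{\mathfrak H^{\otimes m}}$) into $L^2(\Omega)$ with $I_m(h^{\otimes m})=H_m(B(h))$ for $\|h\|_{\mathfrak H}=1$. The $m$-th Wiener chaos is the closed subspace of $L^2(\Omega)$ generated by $\{H_m(B(h)):\|h\|_{\mathfrak H}=1\}$. Fix $T>0$, an integer $q\ge 2$ and $\frac23<H<\frac34$.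 Put $\beta_q=\frac{1}{2^{q-1/2}(q-1)!\sqrt\pi}$, $\mathcal R=\{(s,t):0\le s\le t\le T\}$ and, for $\varepsilon>0$, $$f_{2q-1,\varepsilon,s,t}=(-1)^q\beta_q\,(\varepsilon+(t-s)^{2H})^{-q-\frac12}\,\mathbf 1_{[s,t]}^{\otimes(2q-1)},\qquad f_{2q-1,\varepsilon}=\int_{\mathcal R}f_{2q-1,\varepsilon,s,t}\,ds\,dt$$ (an integral in $\mathfrak H^{\odot(2q-1)}$). Put $p_\varepsilon(x)=(2\pi\varepsilon)^{-1/2}e^{-x^2/(2\varepsilon)}$ and $\alpha_\varepsilon=\int_0^T\int_0^t p_\varepsilon'(B_t-B_s)\,ds\,dt$. Further put $\mu(x,u_1,u_2)=\mathbb E[B_{u_1}(B_{x+u_2}-B_x)]$, $$G^{(q)}_{0,x}(u_1,u_2)=u_1^{-H(1+2q)}\,u_2^{-H(1+2q)}\,\mu(x,u_1,u_2)^{2q-1},$$ $\mathcal S=\{(s_1,s_2,t_1,t_2)\in[0,T]^4: s_1\le t_1,\ s_2\le t_2,\ s_1\le s_2\}$ and $$\overline\sigma_q^2=2(2q-1)!\,\beta_q^2\int_{\mathcal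 S}G^{(q)}_{0,s_2-s_1}(t_1-s_1,t_2-s_2)\,ds_1\,ds_2\,dt_1\,dt_2 .$$ Then: 1. For every $\varepsilon>0$ the integral defining $f_{2q-1,\varepsilon}$ converges absolutely, and $I_{2q-1}(f_{2q-1,\varepsilon})$ is the $(2q-1)$-th chaotic component of $\alpha_\varepsilon$: whenever $B$ is jointly measurable on $[0,T]\times\Omega$ (up to null sets), $\alpha_\varepsilon\in L^2(\Omega)$ and its orthogonal projection on the $(2q-1)$-th Wiener chaos is $I_{2q-1}(f_{2q-1,\varepsilon})$. 2. The integral in $\overline\sigma_q^2$ is absolutely convergent, so $\overline\sigma_q^2$ is finite, and $\mathbb E[I_{2q-1}(f_{2q-1,\varepsilon})^2]\to\overline\sigma_q^2$ as $\varepsilon\to0^+$. 3. $I_{2q-1}(f_{2q-1,\varepsilon})$ converges in $L^2(\Omega)$ as $\varepsilon\to0^+$, and the limit has variance $\overline\sigma_q^2$. -/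

import Mathlib

open MeasureTheory ProbabilityTheory Filter Topology
open scoped NNReal ENNReal

noncomputable section

/-! ### Hilbert tensor powers -/

/-- The algebraic `m`-th tensor power of `E`, to be equipped with the inner product for which
`⟪v₁ ⊗ ⋯ ⊗ vₘ, w₁ ⊗ ⋯ ⊗ wₘ⟫ = ∏ i, ⟪vᵢ, wᵢ⟫`. -/
def AlgTensorPower (E : Type*) [NormedAddCommGroup E] [InnerProductSpace ℝ E] (m : ℕ) : Type _ :=
  PiTensorProduct ℝ (fun _ : Fin m => E)

namespace AlgTensorPower

variable {E : Type*} [NormedAddCommGroup E] [InnerProductSpace ℝ E] {m : ℕ}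

instance : AddCommGroup (AlgTensorPower E m) :=
  inferInstanceAs (AddCommGroup (PiTensorProduct ℝ (fun _ : Fin m => E)))

instance : Module ℝ (AlgTensorPower E m) :=
  inferInstanceAs (Module ℝ (PiTensorProduct ℝ (fun _ : Fin m => E)))

/-- The elementary tensor `v₁ ⊗ ⋯ ⊗ vₘ`. -/
def tprod (v : Fin m → E) : AlgTensorPower E m := PiTensorProduct.tprod ℝ v

/-- The bilinear form on the tensor power induced by the inner product of `E`. -/
def form : AlgTensorPower E m →ₗ[ℝ] AlgTensorPower E m →ₗ[ℝ] ℝ :=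
  (TensorPower.pairingDual ℝ E m) ∘ₗ (PiTensorProduct.map fun _ : Fin m => innerₗ E)

lemma form_tprod (v w : Fin m → E) : form (tprod v) (tprod w) = ∏ i, inner ℝ (v i) (w i) := by
  have h : form (tprod v) = TensorPower.pairingDual ℝ E m
      (PiTensorProduct.map (fun _ : Fin m => innerₗ E) (PiTensorProduct.tprod ℝ v)) := rfl
  rw [h, PiTensorProduct.map_tprod]
  exact TensorPower.pairingDual_tprod_tprod _ _

lemma exists_eq_sum (x : AlgTensorPower E m) :
    ∃ c : (Fin m → E) →₀ ℝ, x = ∑ v ∈ c.support, c v • tprod v := by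
  have hx : x ∈ Submodule.span ℝ (Set.range (tprod (E := E) (m := m))) := by
    have h : Submodule.span ℝ (Set.range (PiTensorProduct.tprod ℝ (s := fun _ : Fin m => E))) = ⊤ :=
      PiTensorProduct.span_tprod_eq_top
    exact h.symm ▸ Submodule.mem_top (x := x)
  obtain ⟨c, hc⟩ := (Finsupp.mem_span_range_iff_exists_finsupp).1 hx
  exact ⟨c, hc.symm⟩

lemma form_symm (x y : AlgTensorPower E m) : form x y = form y x := by
  obtain ⟨c, rfl⟩ := exists_eq_sum x
  obtain ⟨d, rfl⟩ := exists_eq_sum y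
  simp only [map_sum, map_smul, LinearMap.sum_apply, LinearMap.smul_apply, form_tprod, smul_eq_mul]
  simp only [Finset.mul_sum]
  rw [Finset.sum_comm]
  refine Finset.sum_congr rfl fun v _ => Finset.sum_congr rfl fun w _ => ?_
  rw [Finset.prod_congr rfl fun i _ => real_inner_comm (v i) (w i)]
  ring

lemma posSemidef_prod {ι : Type*} [Finite ι] (m : ℕ) (v : ι → Fin m → E) :
    (Matrix.of fun i j => ∏ k, (inner ℝ (v i k) (v j k) : ℝ)).PosSemidef := by
  induction m with
  | zero =>
    have h : (Matrix.of fun i j => ∏ k, (inner ℝ (v i k) (v j k) : ℝ)) =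
        Matrix.gram ℝ (fun _ : ι => (1 : ℝ)) := by
      ext i j
      simp [Matrix.gram]
    rw [h]
    exact Matrix.posSemidef_gram ℝ _
  | succ m ih =>
    have h : (Matrix.of fun i j => ∏ k, (inner ℝ (v i k) (v j k) : ℝ)) =
        (Matrix.gram ℝ (fun i => v i 0)).hadamard
          (Matrix.of fun i j => ∏ k : Fin m, (inner ℝ (v i k.succ) (v j k.succ) : ℝ)) := by
      ext i j
      simp [Matrix.gram, Fin.prod_univ_succ]
    rw [h]
    exact (Matrix.posSemidef_gram ℝ _).hadamard (ih fun i k => v i k.succ)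

lemma form_nonneg (x : AlgTensorPower E m) : 0 ≤ form x x := by
  obtain ⟨c, rfl⟩ := exists_eq_sum x
  have h := (posSemidef_prod m (fun v : c.support => (v : Fin m → E))).dotProduct_mulVec_nonneg
    (fun v => c v)
  rw [← Finset.sum_coe_sort]
  simp only [map_sum, map_smul, LinearMap.sum_apply, LinearMap.smul_apply, form_tprod, smul_eq_mul]
  refine le_of_le_of_eq h ?_
  simp only [dotProduct, Matrix.mulVec, Matrix.of_apply, Pi.star_apply, star_trivial,
    Finset.mul_sum]
  rw [Finset.sum_comm]
  refine Finset.sum_congr rfl fun v _ => Finset.sum_congr rfl fun w _ => ?_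
  ring

instance preInnerCore : PreInnerProductSpace.Core ℝ (AlgTensorPower E m) where
  inner x y := form x y
  conj_inner_symm x y := by simpa using form_symm y x
  re_inner_nonneg x := by simpa using form_nonneg x
  add_left x y z := by simp
  smul_left x y r := by simp

instance : SeminormedAddCommGroup (AlgTensorPower E m) :=
  InnerProductSpace.Core.toSeminormedAddCommGroup (𝕜 := ℝ)

instance : InnerProductSpace ℝ (AlgTensorPower E m) := .ofCore _

lemma inner_tprod (v w : Fin m → E) :
    inner ℝ (tprod v) (tprod w) = ∏ i, inner ℝ (v i) (w i) := form_tprod v w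

end AlgTensorPower

/-- The `m`-th Hilbert tensor power `E^{⊗m}`. -/
abbrev HilbertTensorPower (E : Type*) [NormedAddCommGroup E] [InnerProductSpace ℝ E] (m : ℕ) :
    Type _ := UniformSpace.Completion (AlgTensorPower E m)

section Symmetric

variable {E : Type*} [NormedAddCommGroup E] [InnerProductSpace ℝ E]

/-- The tensor `h^{⊗m}`. -/
def tensorPow (m : ℕ) (h : E) : HilbertTensorPower E m :=
  ((AlgTensorPower.tprod fun _ : Fin m => h : AlgTensorPower E m) : HilbertTensorPower E m)

lemma inner_tensorPow (m : ℕ) (h k : E) :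
    inner ℝ (tensorPow m h) (tensorPow m k) = (inner ℝ h k) ^ m := by
  simp [tensorPow, UniformSpace.Completion.inner_coe, AlgTensorPower.inner_tprod]

variable (E) in
/-- The `m`-th symmetric tensor power `E^{⊙m}`: the closed subspace of `E^{⊗m}` generated by the
tensors `h^{⊗m}`. -/
def SymTensorPower (m : ℕ) : Submodule ℝ (HilbertTensorPower E m) :=
  (Submodule.span ℝ (Set.range (tensorPow (E := E) m))).topologicalClosure

instance (m : ℕ) : CompleteSpace (SymTensorPower E m) :=
  inferInstanceAs (CompleteSpace
    (Submodule.span ℝ (Set.range (tensorPow (E := E) m))).topologicalClosure)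

/-- `h^{⊗m}` as an element of the symmetric tensor power. -/
def symPow (m : ℕ) (h : E) : SymTensorPower E m :=
  ⟨tensorPow m h, Submodule.le_topologicalClosure _ (Submodule.subset_span ⟨h, rfl⟩)⟩

lemma inner_symPow (m : ℕ) (h k : E) :
    inner ℝ (symPow m h) (symPow m k) = (inner ℝ h k) ^ m := inner_tensorPow m h k

lemma denseRange_symPow (m : ℕ) :
    DenseRange (Finsupp.linearCombination ℝ (symPow (E := E) m)) := by
  intro x
  rw [closure_subtype]
  have hx : (x : HilbertTensorPower E m) ∈
      closure (Submodule.span ℝ (Set.range (tensorPow (E := E) m)) : Set _) := x.2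
  convert hx using 2
  ext y
  rw [SetLike.mem_coe, Finsupp.mem_span_range_iff_exists_finsupp]
  constructor
  · rintro ⟨_, ⟨c, rfl⟩, rfl⟩
    exact ⟨c, by simp [Finsupp.linearCombination_apply, Finsupp.sum, symPow]⟩
  · rintro ⟨c, rfl⟩
    exact ⟨_, ⟨c, rfl⟩, by simp [Finsupp.linearCombination_apply, Finsupp.sum, symPow]⟩

end Symmetric

/-- Two families with proportional Gram matrices: norms of linear combinations are proportional. -/
lemma norm_linearCombination_eq {X K L : Type*} [NormedAddCommGroup K] [InnerProductSpace ℝ K]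
    [NormedAddCommGroup L] [InnerProductSpace ℝ L] {u : X → K} {v : X → L} {c : ℝ} (hc : 0 ≤ c)
    (h : ∀ x y, inner ℝ (v x) (v y) = c * inner ℝ (u x) (u y)) (a : X →₀ ℝ) :
    ‖Finsupp.linearCombination ℝ v a‖ = √c * ‖Finsupp.linearCombination ℝ u a‖ := by
  have key : inner ℝ (Finsupp.linearCombination ℝ v a) (Finsupp.linearCombination ℝ v a) =
      c * inner ℝ (Finsupp.linearCombination ℝ u a) (Finsupp.linearCombination ℝ u a) := by
    simp only [Finsupp.linearCombination_apply, Finsupp.sum, sum_inner, inner_sum,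
      real_inner_smul_left, real_inner_smul_right, h, Finset.mul_sum]
    refine Finset.sum_congr rfl fun x _ => Finset.sum_congr rfl fun y _ => ?_
    ring
  rw [real_inner_self_eq_norm_sq, real_inner_self_eq_norm_sq] at key
  have h2 : ‖Finsupp.linearCombination ℝ v a‖ ^ 2 =
      (√c * ‖Finsupp.linearCombination ℝ u a‖) ^ 2 := by
    rw [mul_pow, Real.sq_sqrt hc, key]
  exact (pow_left_inj₀ (norm_nonneg _) (by positivity) two_ne_zero).1 h2


lemma integrable_eval_gaussianReal (p : Polynomial ℝ) (c : ℝ≥0) :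
    Integrable (fun x => p.eval x) (gaussianReal 0 c) := by
  induction p using Polynomial.induction_on' with
  | add p q hp hq =>
    simp only [Polynomial.eval_add]
    exact hp.add hq
  | monomial n a =>
    simp only [Polynomial.eval_monomial]
    refine Integrable.const_mul ?_ a
    have h := (memLp_id_gaussianReal (μ := 0) (v := c) (n : ℝ≥0)).integrable_norm_pow' 
    refine (integrable_norm_iff (by fun_prop)).1 ?_
    simpa using h

lemma integral_mul_eval_gaussianReal (p : Polynomial ℝ) (c : ℝ≥0) :
    ∫ x, x * p.eval x ∂(gaussianReal 0 c) = c * ∫ x, p.derivative.eval x ∂(gaussianReal 0 c) := by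
  by_cases hc : c = 0
  · simp [hc]
  have hint : ∀ r : Polynomial ℝ, Integrable (fun x => gaussianPDFReal 0 c x * r.eval x) := by
    intro r
    have h := integrable_eval_gaussianReal r c
    rw [gaussianReal_of_var_ne_zero _ hc, gaussianPDF_def,
      integrable_withDensity_iff_integrable_smul' (by fun_prop) (by simp)] at h
    simpa [gaussianPDFReal_nonneg] using h
  have hder : ∀ x, HasDerivAt (fun x => (c : ℝ) * (gaussianPDFReal 0 c x * p.eval x))
      (c * (gaussianPDFReal 0 c x * p.derivative.eval x)
        - gaussianPDFReal 0 c x * (Polynomial.X * p).eval x) x := by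
    intro x
    have h1 : HasDerivAt (gaussianPDFReal 0 c) (-(x / c) * gaussianPDFReal 0 c x) x := by
      simp only [gaussianPDFReal_def]
      have h2 : HasDerivAt (fun x : ℝ => -(x - 0) ^ 2 / (2 * (c : ℝ))) (-(x / c)) x := by
        refine ((((hasDerivAt_id x).sub_const 0).pow 2).neg.div_const (2 * (c : ℝ))).congr_deriv ?_
        simp
        field_simp
      refine (h2.exp.const_mul (√(2 * Real.pi * (c : ℝ)))⁻¹).congr_deriv ?_
      ring
    refine ((h1.mul (p.hasDerivAt x)).const_mul (c : ℝ)).congr_deriv ?_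
    have hc' : (c : ℝ) ≠ 0 := by exact_mod_cast hc
    simp only [Polynomial.eval_mul, Polynomial.eval_X]
    field_simp
    ring
  have h0 := integral_eq_zero_of_hasDerivAt_of_integrable hder
    (((hint _).const_mul _).sub (hint _)) ((hint p).const_mul _)
  rw [integral_sub ((hint _).const_mul _) (hint _), integral_const_mul, sub_eq_zero] at h0
  rw [integral_gaussianReal_eq_integral_smul hc, integral_gaussianReal_eq_integral_smul hc]
  simp only [smul_eq_mul, Polynomial.eval_mul, Polynomial.eval_X] at h0 ⊢
  exact h0.symm

/-- The `n`-th Hermite polynomial (probabilists' normalisation, monic), with real coefficients. -/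
def hermiteReal (n : ℕ) : Polynomial ℝ := (Polynomial.hermite n).map (Int.castRingHom ℝ)

lemma hermiteReal_zero : hermiteReal 0 = 1 := by simp [hermiteReal]

lemma hermiteReal_succ (n : ℕ) :
    hermiteReal (n + 1) = Polynomial.X * hermiteReal n - (hermiteReal n).derivative := by
  simp [hermiteReal, Polynomial.hermite_succ, Polynomial.derivative_map]

lemma derivative_hermiteReal_succ (n : ℕ) :
    (hermiteReal (n + 1)).derivative = ((n : ℝ) + 1) • hermiteReal n := by
  induction n with
  | zero => simp [hermiteReal_succ, hermiteReal_zero]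
  | succ n ih =>
    rw [hermiteReal_succ (n + 1), ih, Polynomial.derivative_sub, Polynomial.derivative_mul, ih,
      hermiteReal_succ n]
    rw [Polynomial.derivative_smul]
    simp only [Polynomial.derivative_X, Polynomial.smul_eq_C_mul,
      Nat.cast_add, Nat.cast_one, Polynomial.C_add, Polynomial.C_1]
    ring

lemma integral_hermiteReal_add (ρ : ℝ) (c : ℝ≥0) (hc : (c : ℝ) = 1 - ρ ^ 2) (n : ℕ) (x : ℝ) :
    ∫ z, (hermiteReal n).eval (ρ * x + z) ∂(gaussianReal 0 c) = ρ ^ n * (hermiteReal n).eval x := by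
  have hcomp : ∀ (p : Polynomial ℝ) (z : ℝ), p.eval (ρ * x + z) =
      (p.comp (Polynomial.C (ρ * x) + Polynomial.X)).eval z := by
    intro p z; simp [Polynomial.eval_comp]
  have hint : ∀ p : Polynomial ℝ, Integrable (fun z => p.eval (ρ * x + z)) (gaussianReal 0 c) := by
    intro p
    simp only [hcomp]
    exact integrable_eval_gaussianReal _ c
  have hstep : ∀ n, ∫ z, (hermiteReal (n + 1)).eval (ρ * x + z) ∂(gaussianReal 0 c) =
      ρ * x * ∫ z, (hermiteReal n).eval (ρ * x + z) ∂(gaussianReal 0 c) -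
      ρ ^ 2 * ∫ z, (hermiteReal n).derivative.eval (ρ * x + z) ∂(gaussianReal 0 c) := by
    intro n
    have hst := integral_mul_eval_gaussianReal
      ((hermiteReal n).comp (Polynomial.C (ρ * x) + Polynomial.X)) c
    simp only [← hcomp, Polynomial.derivative_comp, Polynomial.derivative_add,
      Polynomial.derivative_C, Polynomial.derivative_X, zero_add, one_mul] at hst
    have hi2 : Integrable (fun z => z * (hermiteReal n).eval (ρ * x + z)) (gaussianReal 0 c) := by
      have := integrable_eval_gaussianReal
        (Polynomial.X * (hermiteReal n).comp (Polynomial.C (ρ * x) + Polynomial.X)) c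
      simpa [← hcomp] using this
    have h1 : ∀ z, (hermiteReal (n + 1)).eval (ρ * x + z) =
        ρ * x * (hermiteReal n).eval (ρ * x + z) + z * (hermiteReal n).eval (ρ * x + z)
          - (hermiteReal n).derivative.eval (ρ * x + z) := by
      intro z; rw [hermiteReal_succ]; simp; ring
    have hi3 : Integrable (fun z => ρ * x * (hermiteReal n).eval (ρ * x + z)
        + z * (hermiteReal n).eval (ρ * x + z)) (gaussianReal 0 c) :=
      ((hint _).const_mul _).add hi2
    simp only [h1]
    rw [integral_sub hi3 (hint _),
      integral_add ((hint _).const_mul _) hi2, integral_const_mul, hst, hc]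
    ring
  induction n using Nat.strong_induction_on with
  | _ n ih =>
    rcases n with _ | _ | n
    · simp [hermiteReal_zero]
    · rw [hstep 0]
      simp [hermiteReal_zero, hermiteReal_succ]
    · rw [hstep (n + 1), ih (n + 1) (by omega), derivative_hermiteReal_succ]
      simp only [Polynomial.eval_smul, smul_eq_mul, integral_const_mul]
      rw [ih n (by omega), hermiteReal_succ (n + 1), derivative_hermiteReal_succ]
      simp only [Polynomial.eval_sub, Polynomial.eval_mul, Polynomial.eval_X,
        Polynomial.eval_smul, smul_eq_mul]
      ring

lemma integral_hermiteReal_sq (n : ℕ) :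
    ∫ x, (hermiteReal n).eval x * (hermiteReal n).eval x ∂(gaussianReal 0 1) = (n.factorial : ℝ) := by
  induction n with
  | zero => simp [hermiteReal_zero]
  | succ n ih =>
    have hst := integral_mul_eval_gaussianReal (hermiteReal n * hermiteReal (n + 1)) 1
    have hint : ∀ p q : Polynomial ℝ,
        Integrable (fun z => p.eval z * q.eval z) (gaussianReal 0 1) := by
      intro p q
      simpa using integrable_eval_gaussianReal (p * q) 1
    have h1 : ∀ x, (hermiteReal (n + 1)).eval x * (hermiteReal (n + 1)).eval x =
        x * (hermiteReal n * hermiteReal (n + 1)).eval x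
          - (hermiteReal n).derivative.eval x * (hermiteReal (n + 1)).eval x := by
      intro x
      nth_rewrite 1 [hermiteReal_succ]
      simp; ring
    have hi2 : Integrable (fun z => z * (hermiteReal n * hermiteReal (n + 1)).eval z)
        (gaussianReal 0 1) := by
      simpa using hint Polynomial.X (hermiteReal n * hermiteReal (n + 1))
    simp only [h1]
    rw [integral_sub hi2 (hint _ _), hst, Polynomial.derivative_mul, derivative_hermiteReal_succ]
    simp only [Polynomial.eval_add, Polynomial.eval_mul, Polynomial.eval_smul, smul_eq_mul]
    rw [integral_add (hint _ _)]
    · simp only [NNReal.coe_one, one_mul, add_sub_cancel_left]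
      rw [Nat.factorial_succ]
      push_cast
      rw [← ih, ← integral_const_mul]
      congr 1; ext x; ring
    · simpa [smul_eq_mul] using hint (hermiteReal n) (((n : ℝ) + 1) • hermiteReal n)


/-- `B` is a fractional Brownian motion with Hurst parameter `H` under `P`: a centred Gaussian
process indexed by `[0, ∞)` with the fractional covariance. -/
structure IsFractionalBrownianMotion {Ω : Type*} [MeasurableSpace Ω] (H : ℝ)
    (B : ℝ≥0 → Ω → ℝ) (P : Measure Ω) : Prop where
  gaussian : IsGaussianProcess B P
  mean_zero : ∀ t, ∫ ω, B t ω ∂P = 0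
  covariance : ∀ s t, ∫ ω, B s ω * B t ω ∂P =
    (1 / 2) * ((s : ℝ) ^ (2 * H) + (t : ℝ) ^ (2 * H) - |(s : ℝ) - t| ^ (2 * H))

/-- The indicator function `1_[0,t]` on `[0, ∞)`. -/
def indicatorZero (t : ℝ≥0) : ℝ≥0 → ℝ := (Set.Iic t).indicator 1

lemma linearIndependent_indicatorZero : LinearIndependent ℝ indicatorZero := by
  rw [linearIndependent_iff]
  intro c hc
  by_contra hne
  have hs : c.support.Nonempty := Finsupp.support_nonempty_iff.2 hne
  set t := c.support.max' hs with ht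
  have h := congrFun hc t
  have hsum : (Finsupp.linearCombination ℝ indicatorZero c) t = c t := by
    rw [Finsupp.linearCombination_apply, Finsupp.sum, Finset.sum_apply,
      Finset.sum_eq_single_of_mem t (c.support.max'_mem hs)]
    · simp [indicatorZero]
    · intro s hsm hst
      have hlt : s < t := lt_of_le_of_ne (c.support.le_max' s hsm) hst
      simp [indicatorZero, hlt]
  rw [hsum] at h
  exact (Finsupp.mem_support_iff.1 (c.support.max'_mem hs)) h

/-- The space of step functions on `[0, ∞)`: linear combinations of the functions `1_[0,t]`. -/
def stepSpan : Submodule ℝ (ℝ≥0 → ℝ) := Submodule.span ℝ (Set.range indicatorZero)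

section

variable {Ω : Type*} [MeasurableSpace Ω] {H : ℝ} {B : ℝ≥0 → Ω → ℝ} {P : Measure Ω}

/-- `B t` as an element of `L²`. -/
def IsFractionalBrownianMotion.toL2 (hB : IsFractionalBrownianMotion H B P) (t : ℝ≥0) :
    Lp ℝ 2 P := (hB.gaussian.hasGaussianLaw_eval t).memLp_two.toLp (B t)

/-- The linear map from step functions to `L²` which sends `1_[0,t]` to `B t`. -/
def stepIntegral (hB : IsFractionalBrownianMotion H B P) : stepSpan →ₗ[ℝ] Lp ℝ 2 P :=
  (Module.Basis.span linearIndependent_indicatorZero).constr ℝ hB.toL2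

lemma stepIntegral_indicatorZero (hB : IsFractionalBrownianMotion H B P) (t : ℝ≥0) :
    stepIntegral hB ⟨indicatorZero t, Submodule.subset_span ⟨t, rfl⟩⟩ = hB.toL2 t := by
  have h := Module.Basis.constr_basis (Module.Basis.span linearIndependent_indicatorZero) ℝ
    hB.toL2 t
  rwa [Module.Basis.span_apply] at h

/-- The step functions, equipped with the inner product for which
`⟪1_[a,b], 1_[c,d]⟫ = 𝔼[(B b - B a) (B d - B c)]`. -/
@[nolint unusedArguments]
def StepFunction (_hB : IsFractionalBrownianMotion H B P) : Type := stepSpan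

variable (hB : IsFractionalBrownianMotion H B P)

instance : AddCommGroup (StepFunction hB) := inferInstanceAs (AddCommGroup stepSpan)

instance : Module ℝ (StepFunction hB) := inferInstanceAs (Module ℝ stepSpan)

/-- `stepIntegral`, on the type carrying the inner product. -/
def StepFunction.integral : StepFunction hB →ₗ[ℝ] Lp ℝ 2 P := stepIntegral hB

instance : SeminormedAddCommGroup (StepFunction hB) :=
  SeminormedAddCommGroup.induced _ _ (StepFunction.integral hB)

instance : InnerProductSpace ℝ (StepFunction hB) :=
  InnerProductSpace.induced (StepFunction.integral hB)

/-- The Hilbert space `𝔥` of the fractional Brownian motion: the completion of the step functions. -/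
abbrev FbmHilbert : Type := UniformSpace.Completion (StepFunction hB)

/-- The step function `1_[0,t]`. -/
def StepFunction.indicator (t : ℝ≥0) : StepFunction hB :=
  (⟨indicatorZero t, Submodule.subset_span ⟨t, rfl⟩⟩ : stepSpan)

lemma StepFunction.integral_indicator (t : ℝ≥0) :
    StepFunction.integral hB (StepFunction.indicator hB t) = hB.toL2 t :=
  stepIntegral_indicatorZero hB t

/-- The step function `1_(s,t] = 1_[0,t] - 1_[0,s]` for `s ≤ t`, as an element of `𝔥`
(in which it stands for `1_[s,t]`). -/
def fbmIndicator (s t : ℝ≥0) : FbmHilbert hB :=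
  ((StepFunction.indicator hB t - StepFunction.indicator hB s : StepFunction hB) : FbmHilbert hB)

/-- The isometry `h ↦ B(h)` from `𝔥` to `L²` extending `1_[0,t] ↦ B t`. -/
def fbmIntegral : FbmHilbert hB →L[ℝ] Lp ℝ 2 P :=
  (StepFunction.integral hB).extendOfNorm
    (UniformSpace.Completion.toComplₗᵢ (𝕜 := ℝ) (E := StepFunction hB)).toLinearMap

lemma fbmIntegral_coe (f : StepFunction hB) :
    fbmIntegral hB (f : FbmHilbert hB) = StepFunction.integral hB f :=
  LinearMap.extendOfNorm_eq (e := (UniformSpace.Completion.toComplₗᵢ (𝕜 := ℝ)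
    (E := StepFunction hB)).toLinearMap) UniformSpace.Completion.denseRange_coe
    ⟨1, fun x => by
      rw [one_mul]
      exact (UniformSpace.Completion.norm_coe x).ge⟩ f

lemma norm_fbmIntegral (h : FbmHilbert hB) : ‖fbmIntegral hB h‖ = ‖h‖ := by
  induction h using UniformSpace.Completion.induction_on with
  | hp => exact isClosed_eq (by fun_prop) (by fun_prop)
  | ih f =>
    rw [fbmIntegral_coe, UniformSpace.Completion.norm_coe]
    rfl

lemma fbmIntegral_fbmIndicator (s t : ℝ≥0) :
    fbmIntegral hB (fbmIndicator hB s t) = hB.toL2 t - hB.toL2 s := by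
  rw [fbmIndicator, fbmIntegral_coe, map_sub, StepFunction.integral_indicator,
    StepFunction.integral_indicator]

end

section

variable {Ω : Type*} [MeasurableSpace Ω] {H : ℝ} {B : ℝ≥0 → Ω → ℝ} {P : Measure Ω}
  (hB : IsFractionalBrownianMotion H B P)

lemma integral_sq_eq_norm_sq (X : Lp ℝ 2 P) : ∫ ω, X ω * X ω ∂P = ‖X‖ ^ 2 := by
  rw [← real_inner_self_eq_norm_sq, L2.inner_def]
  rfl

lemma inner_L2_eq (X Y : Lp ℝ 2 P) : inner ℝ X Y = ∫ ω, X ω * Y ω ∂P := by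
  rw [L2.inner_def]
  refine integral_congr_ae (ae_of_all _ fun ω => ?_)
  simp [mul_comm]

lemma isProbabilityMeasure_of_fbm (h : IsFractionalBrownianMotion H B P) :
    IsProbabilityMeasure P := h.gaussian.isProbabilityMeasure

lemma map_stepIntegral (f : StepFunction hB) :
    P.map (StepFunction.integral hB f) = gaussianReal 0 (‖StepFunction.integral hB f‖₊ ^ 2) := by
  have := isProbabilityMeasure_of_fbm hB
  set X := StepFunction.integral hB f with hX
  let g : stepSpan := f
  set c : ℝ≥0 →₀ ℝ := (Module.Basis.span linearIndependent_indicatorZero).repr g with hc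
  have hXc : X = ∑ t ∈ c.support, c t • hB.toL2 t := by
    exact Module.Basis.constr_apply (Module.Basis.span linearIndependent_indicatorZero) ℝ hB.toL2 g
  have hae : (X : Ω → ℝ) =ᵐ[P] fun ω => ∑ t ∈ c.support, c t • B t ω := by
    rw [hXc]
    refine (Lp.coeFn_fun_finsetSum _ _).trans ?_
    have h : ∀ᵐ ω ∂P, ∀ t ∈ c.support, (c t • hB.toL2 t : Lp ℝ 2 P) ω = c t • B t ω := by
      refine (ae_ball_iff c.support.countable_toSet).2 fun t _ => ?_
      filter_upwards [Lp.coeFn_smul (c t) (hB.toL2 t),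
        (hB.gaussian.hasGaussianLaw_eval t).memLp_two.coeFn_toLp] with ω h1 h2
      rw [h1, Pi.smul_apply]
      exact congrArg _ h2
    filter_upwards [h] with ω hω
    exact Finset.sum_congr rfl hω
  have hG : HasGaussianLaw X P := by
    refine HasGaussianLaw.congr ?_ hae.symm
    exact (hB.gaussian.smul c).hasGaussianLaw_fun_sum
  have hm : ∫ ω, X ω ∂P = 0 := by
    have hi : ∀ t ∈ c.support, Integrable (fun ω => c t • B t ω) P := fun t _ =>
      (hB.gaussian.hasGaussianLaw_eval t).integrable.smul (c t)
    rw [integral_congr_ae hae, integral_finsetSum _ hi]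
    refine Finset.sum_eq_zero fun t _ => ?_
    rw [integral_smul, hB.mean_zero, smul_zero]
  have hv : Var[X; P] = ‖X‖ ^ 2 := by
    rw [variance_of_integral_eq_zero (Lp.aestronglyMeasurable X).aemeasurable hm,
      ← integral_sq_eq_norm_sq]
    simp only [sq]
  rw [hG.map_eq_gaussianReal, hm, hv]
  congr 1
  exact NNReal.eq (by simp)

lemma continuous_charFun_map [IsProbabilityMeasure P] (t : ℝ) :
    Continuous fun X : Lp ℝ 2 P => charFun (P.map X) t := by
  have hchar : ∀ X : Lp ℝ 2 P, charFun (P.map X) t = ∫ ω, Complex.exp (t * X ω * Complex.I) ∂P := by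
    intro X
    rw [charFun_apply_real, integral_map (Lp.aestronglyMeasurable X).aemeasurable
      (by fun_prop)]
  have hint : ∀ X : Lp ℝ 2 P, Integrable (fun ω => Complex.exp (t * X ω * Complex.I)) P := by
    intro X
    refine Integrable.of_bound (C := 1) ?_ (ae_of_all _ fun ω => ?_)
    · have := (Lp.aestronglyMeasurable X).aemeasurable
      refine AEMeasurable.aestronglyMeasurable (by fun_prop)
    · rw [← Complex.ofReal_mul, Complex.norm_exp_ofReal_mul_I]
  refine (LipschitzWith.of_dist_le_mul (K := ‖t‖₊) fun X Y => ?_).continuous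
  rw [dist_eq_norm, hchar, hchar, ← integral_sub (hint X) (hint Y)]
  have hpt : ∀ ω, ‖Complex.exp (t * X ω * Complex.I) - Complex.exp (t * Y ω * Complex.I)‖ ≤
      ‖t‖ * ‖X ω - Y ω‖ := by
    intro ω
    have h1 : Complex.exp (t * X ω * Complex.I) - Complex.exp (t * Y ω * Complex.I) =
        Complex.exp ((t * Y ω : ℝ) * Complex.I) *
          (Complex.exp (Complex.I * (t * (X ω - Y ω) : ℝ)) - 1) := by
      rw [mul_sub, ← Complex.exp_add, mul_one]
      congr 2
      · push_cast; ring
      · push_cast; ring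
    rw [h1, norm_mul, Complex.norm_exp_ofReal_mul_I, one_mul, ← norm_mul]
    exact Real.norm_exp_I_mul_ofReal_sub_one_le
  have hXY : MemLp (fun ω => X ω - Y ω) 2 P := (Lp.memLp X).sub (Lp.memLp Y)
  calc ‖∫ ω, (Complex.exp (t * X ω * Complex.I) - Complex.exp (t * Y ω * Complex.I)) ∂P‖
      ≤ ∫ ω, ‖t‖ * ‖X ω - Y ω‖ ∂P :=
        norm_integral_le_of_norm_le ((hXY.integrable one_le_two).norm.const_mul _)
          (ae_of_all _ hpt)
    _ = ‖t‖ * ∫ ω, ‖X ω - Y ω‖ ∂P := integral_const_mul _ _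
    _ ≤ ‖t‖ * dist X Y := by
        gcongr
        rw [Lp.dist_def, integral_norm_eq_lintegral_enorm hXY.1, ← eLpNorm_one_eq_lintegral_enorm]
        refine ENNReal.toReal_mono ?_
          (eLpNorm_le_eLpNorm_of_exponent_le one_le_two hXY.1)
        exact hXY.2.ne

lemma map_fbmIntegral (h : FbmHilbert hB) :
    P.map (fbmIntegral hB h) = gaussianReal 0 (‖h‖₊ ^ 2) := by
  have := isProbabilityMeasure_of_fbm hB
  refine Measure.ext_of_charFun (funext fun t => ?_)
  induction h using UniformSpace.Completion.induction_on with
  | hp =>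
    refine isClosed_eq ((continuous_charFun_map t).comp (by fun_prop)) ?_
    simp only [charFun_gaussianReal]
    fun_prop
  | ih f =>
    rw [fbmIntegral_coe, map_stepIntegral, ← fbmIntegral_coe]
    congr 3
    exact NNReal.eq (norm_fbmIntegral hB _)

/-- `B(h)` and `B(k)` are jointly Gaussian. -/
lemma hasGaussianLaw_fbmIntegral_pair (h k : FbmHilbert hB) :
    HasGaussianLaw (fun ω => (fbmIntegral hB h ω, fbmIntegral hB k ω)) P := by
  have := isProbabilityMeasure_of_fbm hB
  have hm1 := (Lp.aestronglyMeasurable (fbmIntegral hB h)).aemeasurable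
  have hm2 := (Lp.aestronglyMeasurable (fbmIntegral hB k)).aemeasurable
  refine ⟨isGaussian_of_map_eq_gaussianReal fun L => ?_⟩
  refine ⟨0, ‖L (1, 0) • h + L (0, 1) • k‖₊ ^ 2, ?_⟩
  rw [← map_fbmIntegral, AEMeasurable.map_map_of_aemeasurable (by fun_prop) (by fun_prop)]
  refine Measure.map_congr ?_
  rw [map_add, map_smul, map_smul]
  filter_upwards [Lp.coeFn_add (L (1, 0) • fbmIntegral hB h) (L (0, 1) • fbmIntegral hB k),
    Lp.coeFn_smul (L (1, 0)) (fbmIntegral hB h), Lp.coeFn_smul (L (0, 1)) (fbmIntegral hB k)]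
    with ω h1 h2 h3
  rw [h1, Pi.add_apply, h2, h3, Function.comp_apply]
  have hL : ((fbmIntegral hB h ω, fbmIntegral hB k ω) : ℝ × ℝ) =
      fbmIntegral hB h ω • (1, 0) + fbmIntegral hB k ω • (0, 1) := by simp
  rw [hL, map_add, map_smul, map_smul]
  simp [mul_comm]

lemma memLp_hermite (m : ℕ) (h : FbmHilbert hB) :
    MemLp (fun ω => (hermiteReal m).eval (fbmIntegral hB h ω)) 2 P := by
  have hm := (Lp.aestronglyMeasurable (fbmIntegral hB h)).aemeasurable
  have h1 : MemLp (fun x => (hermiteReal m).eval x) 2 (P.map (fbmIntegral hB h)) := by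
    rw [map_fbmIntegral, memLp_two_iff_integrable_sq (by fun_prop)]
    refine (integrable_eval_gaussianReal (hermiteReal m * hermiteReal m) (‖h‖₊ ^ 2)).congr
      (ae_of_all _ fun x => ?_)
    simp only [Polynomial.eval_mul, sq]
  exact h1.comp_of_map hm

/-- `H_m(B(h)) ∈ L²`, with `H_m` the `m`-th Hermite polynomial. -/
def hermiteL2 (m : ℕ) (h : FbmHilbert hB) : Lp ℝ 2 P := (memLp_hermite hB m h).toLp _

lemma inner_hermiteL2 (m : ℕ) {h k : FbmHilbert hB} (hh : ‖h‖ = 1) (hk : ‖k‖ = 1) :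
    inner ℝ (hermiteL2 hB m h) (hermiteL2 hB m k) = (m.factorial : ℝ) * (inner ℝ h k) ^ m := by
  have := isProbabilityMeasure_of_fbm hB
  set ρ : ℝ := inner ℝ h k with hρ
  set l : FbmHilbert hB := k - ρ • h with hl
  have hlsq : ‖l‖ ^ 2 = 1 - ρ ^ 2 := by
    rw [hl, norm_sub_sq_real, norm_smul, real_inner_smul_right, real_inner_comm, hh, hk, ← hρ,
      mul_one, Real.norm_eq_abs, sq_abs]
    ring
  have hhl : inner ℝ h l = 0 := by
    rw [hl, inner_sub_right, real_inner_smul_right, real_inner_self_eq_norm_sq, hh, ← hρ]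
    ring
  set X := fbmIntegral hB h with hX
  set Z := fbmIntegral hB l with hZ
  have hXm := (Lp.aestronglyMeasurable X).aemeasurable
  have hZm := (Lp.aestronglyMeasurable Z).aemeasurable
  have hinner : ∀ a b, inner ℝ (fbmIntegral hB a) (fbmIntegral hB b) = inner ℝ a b :=
    (LinearMap.norm_map_iff_inner_map_map (𝕜 := ℝ) (fbmIntegral hB)).1 (norm_fbmIntegral hB)
  have hmean : ∀ a, ∫ ω, fbmIntegral hB a ω ∂P = 0 := by
    intro a
    have h1 := integral_map (f := fun x : ℝ => x)
      (Lp.aestronglyMeasurable (fbmIntegral hB a)).aemeasurable (by fun_prop)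
    rw [map_fbmIntegral, integral_id_gaussianReal] at h1
    exact h1.symm
  have hind : IndepFun X Z P := by
    refine (hasGaussianLaw_fbmIntegral_pair hB h l).indepFun_of_covariance_eq_zero ?_
    rw [covariance_eq_sub (Lp.memLp _) (Lp.memLp _), hmean, hmean, mul_zero, sub_zero]
    refine Eq.trans ?_ ((inner_L2_eq X Z).symm.trans ((hinner h l).trans hhl))
    rfl
  have hlaw : P.map (fun ω => (X ω, Z ω)) =
      (gaussianReal 0 1).prod (gaussianReal 0 (‖l‖₊ ^ 2)) := by
    rw [(indepFun_iff_map_prod_eq_prod_map_map hXm hZm).1 hind, hX, hZ, map_fbmIntegral,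
      map_fbmIntegral]
    congr 2
    exact NNReal.eq (by simp [hh])
  have hYae : (fbmIntegral hB k : Ω → ℝ) =ᵐ[P] fun ω => ρ * X ω + Z ω := by
    have hk' : fbmIntegral hB k = ρ • X + Z := by
      rw [hX, hZ, hl, map_sub, map_smul]; abel
    rw [hk']
    filter_upwards [Lp.coeFn_add (ρ • X) Z, Lp.coeFn_smul ρ X] with ω h1 h2
    rw [h1, Pi.add_apply, h2]; rfl
  rw [inner_L2_eq]
  calc ∫ ω, hermiteL2 hB m h ω * hermiteL2 hB m k ω ∂P
      = ∫ ω, (fun p : ℝ × ℝ => (hermiteReal m).eval p.1 * (hermiteReal m).eval (ρ * p.1 + p.2))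
          (X ω, Z ω) ∂P := by
        refine integral_congr_ae ?_
        filter_upwards [(memLp_hermite hB m h).coeFn_toLp, (memLp_hermite hB m k).coeFn_toLp, hYae]
          with ω h1 h2 h3
        rw [hermiteL2, hermiteL2, h1, h2, h3]
    _ = ∫ p, (hermiteReal m).eval p.1 * (hermiteReal m).eval (ρ * p.1 + p.2)
          ∂((gaussianReal 0 1).prod (gaussianReal 0 (‖l‖₊ ^ 2))) := by
        rw [← hlaw, integral_map (by fun_prop) (by fun_prop)]
    _ = ∫ x, ∫ z, (hermiteReal m).eval x * (hermiteReal m).eval (ρ * x + z)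
          ∂(gaussianReal 0 (‖l‖₊ ^ 2)) ∂(gaussianReal 0 1) := by
        refine integral_prod _ ?_
        have h1 : MemLp (fun ω => (hermiteReal m).eval (X ω)) 2 P := memLp_hermite hB m h
        have h2 : MemLp (fun ω => (hermiteReal m).eval (ρ * X ω + Z ω)) 2 P :=
          (memLp_hermite hB m k).ae_eq (by filter_upwards [hYae] with ω hω; rw [hω])
        rw [← hlaw, integrable_map_measure (by fun_prop) (by fun_prop)]
        exact h1.integrable_mul h2
    _ = ∫ x, ρ ^ m * ((hermiteReal m).eval x * (hermiteReal m).eval x) ∂(gaussianReal 0 1) := by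
        refine integral_congr_ae (ae_of_all _ fun x => ?_)
        simp only
        rw [integral_const_mul, integral_hermiteReal_add ρ _ (by simpa using hlsq)]
        ring
    _ = (m.factorial : ℝ) * ρ ^ m := by
        rw [integral_const_mul, integral_hermiteReal_sq]
        ring

/-- The image of `h^{⊗m}` under the multiple Wiener integral: `‖h‖ ^ m H_m(B(h / ‖h‖))`. -/
def wienerPow (m : ℕ) (h : FbmHilbert hB) : Lp ℝ 2 P := ‖h‖ ^ m • hermiteL2 hB m (‖h‖⁻¹ • h)

lemma inner_wienerPow (m : ℕ) (h k : FbmHilbert hB) :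
    inner ℝ (wienerPow hB m h) (wienerPow hB m k) =
      (m.factorial : ℝ) * inner ℝ (symPow m h) (symPow m k) := by
  rw [inner_symPow]
  have := isProbabilityMeasure_of_fbm hB
  rcases Nat.eq_zero_or_pos m with rfl | hm
  · simp only [wienerPow, pow_zero, one_smul, inner_L2_eq]
    rw [integral_congr_ae (g := fun _ => (1 : ℝ))]
    · simp
    · filter_upwards [(memLp_hermite hB 0 (‖h‖⁻¹ • h)).coeFn_toLp,
        (memLp_hermite hB 0 (‖k‖⁻¹ • k)).coeFn_toLp] with ω h1 h2
      rw [hermiteL2, hermiteL2, h1, h2]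
      simp [hermiteReal_zero]
  · by_cases hh : h = 0
    · simp [hh, wienerPow, hm.ne']
    by_cases hk : k = 0
    · simp [hk, wienerPow, hm.ne']
    have hh' : ‖h‖ ≠ 0 := norm_ne_zero_iff.2 hh
    have hk' : ‖k‖ ≠ 0 := norm_ne_zero_iff.2 hk
    rw [wienerPow, wienerPow, real_inner_smul_left, real_inner_smul_right,
      inner_hermiteL2 hB m (by simp [norm_smul, hh']) (by simp [norm_smul, hk']),
      real_inner_smul_left, real_inner_smul_right, mul_pow, mul_pow]
    simp only [inv_pow]
    field_simp

/-- The multiple Wiener integral `I_m` on the symmetric tensor power `𝔥^{⊙m}`: the continuous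
linear extension of `h^{⊗m} ↦ ‖h‖ ^ m H_m(B(h / ‖h‖))`. -/
def multipleIntegral (m : ℕ) : SymTensorPower (FbmHilbert hB) m →L[ℝ] Lp ℝ 2 P :=
  (Finsupp.linearCombination ℝ (wienerPow hB m)).extendOfNorm
    (Finsupp.linearCombination ℝ (symPow m))

/-- `I_m(h^{⊗m}) = H_m(B(h))` for unit vectors `h`. -/
lemma multipleIntegral_symPow (m : ℕ) {h : FbmHilbert hB} (hh : ‖h‖ = 1) :
    multipleIntegral hB m (symPow m h) = hermiteL2 hB m h := by
  have h1 := LinearMap.extendOfNorm_eq (f := Finsupp.linearCombination ℝ (wienerPow hB m))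
    (denseRange_symPow m) ⟨√(m.factorial : ℝ), fun a =>
      (norm_linearCombination_eq (by positivity) (inner_wienerPow hB m) a).le⟩
    (Finsupp.single h 1)
  simp only [Finsupp.linearCombination_single, one_smul] at h1
  rw [multipleIntegral, h1, wienerPow, hh]
  simp

/-- `I_m` is an isometry when `𝔥^{⊙m}` carries the norm `√(m!) ‖·‖`. -/
lemma norm_multipleIntegral (m : ℕ) (f : SymTensorPower (FbmHilbert hB) m) :
    ‖multipleIntegral hB m f‖ = √(m.factorial : ℝ) * ‖f‖ := by
  have hn := norm_linearCombination_eq (c := (m.factorial : ℝ)) (by positivity)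
    (inner_wienerPow hB m)
  refine (denseRange_symPow m).induction_on f (isClosed_eq (by fun_prop) (by fun_prop)) fun a => ?_
  rw [multipleIntegral, LinearMap.extendOfNorm_eq (denseRange_symPow m) ⟨_, fun a => (hn a).le⟩, hn]

end

/-! ### The approximations of the derivative of self-intersection local time -/

section

variable {Ω : Type*} [MeasurableSpace Ω] {H : ℝ} {B : ℝ≥0 → Ω → ℝ} {P : Measure Ω}

/-- The `m`-th Wiener chaos: the closed subspace of `L²` generated by the variables `H_m(B(h))`
with `‖h‖ = 1`. -/
def wienerChaos (hB : IsFractionalBrownianMotion H B P) (m : ℕ) : Submodule ℝ (Lp ℝ 2 P) :=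
  (Submodule.span ℝ {X | ∃ h : FbmHilbert hB, ‖h‖ = 1 ∧ X = hermiteL2 hB m h}).topologicalClosure

instance (hB : IsFractionalBrownianMotion H B P) (m : ℕ) : CompleteSpace (wienerChaos hB m) :=
  inferInstanceAs (CompleteSpace (Submodule.span ℝ
    {X | ∃ h : FbmHilbert hB, ‖h‖ = 1 ∧ X = hermiteL2 hB m h}).topologicalClosure)

/-- The heat kernel `p_ε(x) = (2 π ε)^{-1/2} exp (-x² / (2 ε))`. -/
def heatKernel (ε x : ℝ) : ℝ := (2 * Real.pi * ε) ^ (-(1 / 2) : ℝ) * Real.exp (-x ^ 2 / (2 * ε))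

/-- `α_ε = ∫_0^T ∫_0^t p_ε'(B_t - B_s) ds dt`. -/
def alphaEps (B : ℝ≥0 → Ω → ℝ) (T ε : ℝ) (ω : Ω) : ℝ :=
  ∫ t in (0 : ℝ)..T, ∫ s in (0 : ℝ)..t,
    deriv (heatKernel ε) (B t.toNNReal ω - B s.toNNReal ω)

/-- `β_q = 1 / (2^{q - 1/2} (q - 1)! √π)`, for `q ≥ 1`. -/
def betaConst (q : ℕ) : ℝ :=
  1 / ((2 : ℝ) ^ ((q : ℝ) - 1 / 2) * ((q - 1).factorial : ℝ) * √Real.pi)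

/-- The kernel `f_{2q-1,ε,s,t} = (-1)^q β_q (ε + (t - s)^{2H})^{-q-1/2} 1_[s,t]^{⊗(2q-1)}`. -/
def chaosKernelAt (hB : IsFractionalBrownianMotion H B P) (q : ℕ) (ε s t : ℝ) :
    SymTensorPower (FbmHilbert hB) (2 * q - 1) :=
  ((-1) ^ q * betaConst q * (ε + (t - s) ^ (2 * H)) ^ (-(q : ℝ) - 1 / 2)) •
    symPow (2 * q - 1) (fbmIndicator hB s.toNNReal t.toNNReal)

/-- `𝓡 = {(s, t) : 0 ≤ s ≤ t ≤ T}`. -/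
def regionR (T : ℝ) : Set (ℝ × ℝ) := {p | 0 ≤ p.1 ∧ p.1 ≤ p.2 ∧ p.2 ≤ T}

/-- The kernel `f_{2q-1,ε} = ∫_𝓡 f_{2q-1,ε,s,t} ds dt`. -/
def chaosKernel (hB : IsFractionalBrownianMotion H B P) (T : ℝ) (q : ℕ) (ε : ℝ) :
    SymTensorPower (FbmHilbert hB) (2 * q - 1) :=
  ∫ p in regionR T, chaosKernelAt hB q ε p.1 p.2

/-- `I_{2q-1}(f_{2q-1,ε})`. -/
def chaosComponent (hB : IsFractionalBrownianMotion H B P) (T : ℝ) (q : ℕ) (ε : ℝ) : Lp ℝ 2 P :=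
  multipleIntegral hB (2 * q - 1) (chaosKernel hB T q ε)

/-- `μ(x, u₁, u₂) = 𝔼[B_{u₁} (B_{x+u₂} - B_x)]`. -/
def muCov (B : ℝ≥0 → Ω → ℝ) (P : Measure Ω) (x u₁ u₂ : ℝ) : ℝ :=
  ∫ ω, B u₁.toNNReal ω * (B (x + u₂).toNNReal ω - B x.toNNReal ω) ∂P

/-- `G^{(q)}_{ε,x}(u₁, u₂)
  = (ε + u₁^{2H})^{-1/2-q} (ε + u₂^{2H})^{-1/2-q} μ(x, u₁, u₂)^{2q-1}`. -/
def GKernel (H : ℝ) (B : ℝ≥0 → Ω → ℝ) (P : Measure Ω) (q : ℕ) (ε x u₁ u₂ : ℝ) : ℝ :=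
  (ε + u₁ ^ (2 * H)) ^ (-(1 / 2) - (q : ℝ)) * (ε + u₂ ^ (2 * H)) ^ (-(1 / 2) - (q : ℝ)) *
    muCov B P x u₁ u₂ ^ (2 * q - 1)

/-- `𝓢 = {(s₁, s₂, t₁, t₂) ∈ [0,T]⁴ : s₁ ≤ t₁, s₂ ≤ t₂, s₁ ≤ s₂}`. -/
def regionS (T : ℝ) : Set (ℝ × ℝ × ℝ × ℝ) :=
  {p | p.1 ∈ Set.Icc 0 T ∧ p.2.1 ∈ Set.Icc 0 T ∧ p.2.2.1 ∈ Set.Icc 0 T ∧ p.2.2.2 ∈ Set.Icc 0 T ∧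
    p.1 ≤ p.2.2.1 ∧ p.2.1 ≤ p.2.2.2 ∧ p.1 ≤ p.2.1}

/-- The integrand `(s₁, s₂, t₁, t₂) ↦ G^{(q)}_{0,s₂-s₁}(t₁ - s₁, t₂ - s₂)`. -/
def limitIntegrand (H : ℝ) (B : ℝ≥0 → Ω → ℝ) (P : Measure Ω) (q : ℕ) (p : ℝ × ℝ × ℝ × ℝ) : ℝ :=
  GKernel H B P q 0 (p.2.1 - p.1) (p.2.2.1 - p.1) (p.2.2.2 - p.2.1)

/-- `2 (2q-1)! β_q² ∫_𝓢 G^{(q)}_{0,s₂-s₁}(t₁ - s₁, t₂ - s₂) ds₁ ds₂ dt₁ dt₂`. -/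
def limitVariance (H : ℝ) (B : ℝ≥0 → Ω → ℝ) (P : Measure Ω) (T : ℝ) (q : ℕ) : ℝ :=
  2 * ((2 * q - 1).factorial : ℝ) * betaConst q ^ 2 * ∫ p in regionS T, limitIntegrand H B P q p

end

end

noncomputable section

/-! ### The rectangular increments of `|x| ^ p` -/

/-! By the isometry of the multiple integral, the covariance of the components at levels `ε` and `η`
is `(2q-1)!` times the integral over `𝓡 × 𝓡` of the explicit kernel `covKernel H q ε η`
(`inner_chaosComponent`). If these covariances have one limit `L` as `ε` and `η` tend to `0`
independently, then `‖X_ε - X_η‖² → L - 2L + L = 0`. So one dominated convergence gives both the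
limit in `L²` and its variance.

For the domination write `u`, `v` for the lengths of the two time intervals, `x` for the difference
of their left ends and `m` for the covariance of the two increments. At `ε = η = 0` the kernel is a
constant times `(uv)^(-H(2q+1)) m^(2q-1)`, homogeneous of degree `-4H` in `(u, v, x)`. The bound
spreads this degree equally, as `(u v |x|)^(-4H/3)`, which is locally integrable exactly when `H <
3/4`. It is reached by bounding `2q-4` factors `m` with Cauchy-Schwarz, `m ≤ (uv)^H`, and the
remaining three with `m ≤ 4H (uv)^(11H/9) |x|^(-4H/9)`; this second bound is interpolated from
`rectIncrement_le`. Positive `ε`, `η` only make the kernel smaller, because `m ≥ 0`.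

The identification with the projection of `α_ε` (`starProjection_alphaEps`) tests against the
generators `H_{2q-1}(B(h))`. By Fubini it reduces to `𝔼[p_ε'(B(k)) H_{2q-1}(B(h))]`, a Gaussian
integral in which `β_q` appears. The symmetry under exchange of the two intervals turns `𝓡 × 𝓡` into
twice `𝓢`. -/

lemma abs_rpow_sub_two_mul_self_of_nonneg {p y : ℝ} (hp : 1 < p) (hy : 0 ≤ y) :
    |y| ^ (p - 2) * y = y ^ (p - 1) := by
  rcases hy.eq_or_lt with rfl | hy
  · simp [Real.zero_rpow (by linarith : p - 1 ≠ 0)]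
  · rw [abs_of_pos hy, ← Real.rpow_add_one hy.ne']
    ring_nf

lemma abs_rpow_sub_two_mul_self_of_nonpos {p y : ℝ} (hp : 1 < p) (hy : y ≤ 0) :
    |y| ^ (p - 2) * y = -(-y) ^ (p - 1) := by
  rw [← abs_rpow_sub_two_mul_self_of_nonneg hp (neg_nonneg.2 hy), abs_neg]
  ring

lemma rpow_sub_rpow_le_rpow_sub {r y z : ℝ} (hr : 0 ≤ r) (hr1 : r ≤ 1) (hz : 0 ≤ z) (h : z ≤ y) :
    y ^ r - z ^ r ≤ (y - z) ^ r := by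
  have := Real.rpow_add_le_add_rpow hz (sub_nonneg.2 h) hr hr1
  rw [add_sub_cancel] at this
  linarith

/-- Up to the factor `p`, this signed power is the derivative of `|y| ^ p`; its monotonicity is the
convexity that makes the rectangular increments nonnegative. -/
lemma abs_rpow_sub_two_mul_self_mono {p : ℝ} (hp : 1 < p) :
    Monotone fun y : ℝ => |y| ^ (p - 2) * y := by
  intro z y h
  have hp' : 0 ≤ p - 1 := by linarith
  simp only
  rcases le_total 0 z with hz | hz
  · rw [abs_rpow_sub_two_mul_self_of_nonneg hp hz,
      abs_rpow_sub_two_mul_self_of_nonneg hp (hz.trans h)]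
    exact Real.rpow_le_rpow hz h hp'
  · rw [abs_rpow_sub_two_mul_self_of_nonpos hp hz]
    rcases le_total 0 y with hy | hy
    · rw [abs_rpow_sub_two_mul_self_of_nonneg hp hy]
      have := Real.rpow_nonneg hy (p - 1)
      have := Real.rpow_nonneg (neg_nonneg.2 hz) (p - 1)
      linarith
    · rw [abs_rpow_sub_two_mul_self_of_nonpos hp hy]
      exact neg_le_neg (Real.rpow_le_rpow (neg_nonneg.2 hy) (neg_le_neg h) hp')

/-- Hölder continuity of the signed power. The factor `2` is needed only for opposite signs, where
each of the two terms is at most `(y - z) ^ (p - 1)`. -/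
lemma abs_rpow_sub_two_mul_self_sub_le {p y z : ℝ} (hp : 1 < p) (hp2 : p ≤ 2) (h : z ≤ y) :
    |y| ^ (p - 2) * y - |z| ^ (p - 2) * z ≤ 2 * (y - z) ^ (p - 1) := by
  have hp' : 0 ≤ p - 1 := by linarith
  have hp1 : p - 1 ≤ 1 := by linarith
  have h0 := Real.rpow_nonneg (sub_nonneg.2 h) (p - 1)
  rcases le_total 0 z with hz | hz
  · rw [abs_rpow_sub_two_mul_self_of_nonneg hp hz,
      abs_rpow_sub_two_mul_self_of_nonneg hp (hz.trans h)]
    linarith [rpow_sub_rpow_le_rpow_sub hp' hp1 hz h]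
  · rw [abs_rpow_sub_two_mul_self_of_nonpos hp hz]
    rcases le_total 0 y with hy | hy
    · rw [abs_rpow_sub_two_mul_self_of_nonneg hp hy]
      have h1 := Real.rpow_le_rpow hy (by linarith : y ≤ y - z) hp'
      have h2 := Real.rpow_le_rpow (neg_nonneg.2 hz) (by linarith : -z ≤ y - z) hp'
      linarith
    · rw [abs_rpow_sub_two_mul_self_of_nonpos hp hy]
      have h1 := rpow_sub_rpow_le_rpow_sub hp' hp1 (neg_nonneg.2 hy) (neg_le_neg h)
      rw [show -z - -y = y - z by ring] at h1
      linarith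

/-- Bernoulli's inequality for `1 + u / z`, scaled by `z ^ r`. -/
lemma rpow_add_sub_rpow_le {r z u : ℝ} (hr : 0 ≤ r) (hr1 : r ≤ 1) (hz : 0 < z) (hu : 0 ≤ u) :
    (z + u) ^ r - z ^ r ≤ r * u * z ^ (r - 1) := by
  have h1 := rpow_one_add_le_one_add_mul_self (s := u / z) (p := r)
    (by have : 0 ≤ u / z := by positivity
        linarith) hr hr1
  have h2 : z + u = z * (1 + u / z) := by field_simp
  rw [h2, Real.mul_rpow hz.le (by positivity), Real.rpow_sub_one hz.ne']
  have h3 := mul_le_mul_of_nonneg_left h1 (Real.rpow_nonneg hz.le r)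
  calc z ^ r * (1 + u / z) ^ r - z ^ r ≤ z ^ r * (1 + r * (u / z)) - z ^ r := by linarith
    _ = r * u * (z ^ r / z) := by field_simp; ring

/-- The rectangular increment of `|x| ^ p`. -/
def rectIncrement (p x u v : ℝ) : ℝ := |x + v| ^ p - |x| ^ p - |x + v - u| ^ p + |x - u| ^ p

/-- The rectangular increment is the increment of this function from `x` to `x + v`, so its sign and
its upper bounds follow from those of the derivative. -/
lemma hasDerivAt_abs_rpow_sub_shift {p : ℝ} (hp : 1 < p) (u y : ℝ) :
    HasDerivAt (fun y : ℝ => |y| ^ p - |y - u| ^ p)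
      (p * (|y| ^ (p - 2) * y - |y - u| ^ (p - 2) * (y - u))) y := by
  refine ((hasDerivAt_abs_rpow y hp).sub
    ((hasDerivAt_abs_rpow (y - u) hp).comp_sub_const y u)).congr_deriv ?_
  ring

lemma rectIncrement_nonneg {p u v : ℝ} (hp : 1 < p) (x : ℝ) (hu : 0 ≤ u) (hv : 0 ≤ v) :
    0 ≤ rectIncrement p x u v := by
  have h := monotone_of_hasDerivAt_nonneg (hasDerivAt_abs_rpow_sub_shift hp u) (fun y =>
    mul_nonneg (by linarith)
      (sub_nonneg.2 (abs_rpow_sub_two_mul_self_mono hp (by linarith : y - u ≤ y))))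
    (by linarith : x ≤ x + v)
  simp only at h
  rw [rectIncrement]
  linarith

lemma rectIncrement_le_of_deriv_le {p u v C : ℝ} (hp : 1 < p) (x : ℝ) (hv : 0 ≤ v)
    (hC : ∀ y, x ≤ y → p * (|y| ^ (p - 2) * y - |y - u| ^ (p - 2) * (y - u)) ≤ C) :
    rectIncrement p x u v ≤ C * v := by
  have hd := hasDerivAt_abs_rpow_sub_shift hp u
  have h := (convex_Ici x).image_sub_le_mul_sub_of_deriv_le
    (f := fun y : ℝ => |y| ^ p - |y - u| ^ p) (C := C)
    (fun y _ => (hd y).continuousAt.continuousWithinAt)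
    (fun y _ => (hd y).differentiableAt.differentiableWithinAt)
    (fun y hy => by rw [(hd y).deriv]; exact hC y (interior_subset hy)) x (by simp)
    (x + v) (by simpa using hv) (by linarith)
  simp only [add_sub_cancel_left] at h
  rw [rectIncrement]
  linarith

lemma rectIncrement_le_holder {p u v : ℝ} (hp : 1 < p) (hp2 : p ≤ 2) (x : ℝ) (hu : 0 ≤ u)
    (hv : 0 ≤ v) : rectIncrement p x u v ≤ 2 * p * u ^ (p - 1) * v := by
  refine rectIncrement_le_of_deriv_le hp x hv fun y _ => ?_
  have h := abs_rpow_sub_two_mul_self_sub_le hp hp2 (by linarith : y - u ≤ y)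
  rw [sub_sub_cancel] at h
  nlinarith

/-- When `x ≥ 2u` the signed power is only evaluated at points `≥ x / 2`, away from its singularity,
and the Bernoulli bound replaces the Hölder one. The exponent `p - 2 ≥ -1` makes the passage from `x
/ 2` to `x` cost at most a factor `2`. -/
lemma rectIncrement_le_of_two_mul_le {p x u v : ℝ} (hp : 1 < p) (hp2 : p ≤ 2) (hx : 0 < x)
    (hu : 0 ≤ u) (hv : 0 ≤ v) (hux : 2 * u ≤ x) :
    rectIncrement p x u v ≤ 2 * p * (u * v * x ^ (p - 2)) := by
  have h : rectIncrement p x u v ≤ (p * ((p - 1) * u * (x / 2) ^ (p - 2))) * v := by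
    refine rectIncrement_le_of_deriv_le hp x hv fun y hy => ?_
    have hyu : x / 2 ≤ y - u := by linarith
    have hyu0 : 0 < y - u := by linarith
    rw [abs_rpow_sub_two_mul_self_of_nonneg hp (by linarith),
      abs_rpow_sub_two_mul_self_of_nonneg hp hyu0.le]
    have h1 := rpow_add_sub_rpow_le (by linarith) (by linarith : p - 1 ≤ 1) hyu0 hu
    rw [sub_add_cancel, sub_sub, one_add_one_eq_two] at h1
    have h2 : (y - u) ^ (p - 2) ≤ (x / 2) ^ (p - 2) :=
      Real.rpow_le_rpow_of_nonpos (by linarith) hyu (by linarith)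
    refine mul_le_mul_of_nonneg_left (h1.trans ?_) (by linarith)
    exact mul_le_mul_of_nonneg_left h2 (mul_nonneg (by linarith) hu)
  have h3 : (x / 2) ^ (p - 2) ≤ 2 * x ^ (p - 2) := by
    rw [Real.div_rpow hx.le (by norm_num), div_eq_mul_inv, ← Real.rpow_neg (by norm_num), mul_comm]
    refine mul_le_mul_of_nonneg_right ?_ (by positivity)
    calc (2 : ℝ) ^ (-(p - 2)) ≤ 2 ^ (1 : ℝ) :=
          Real.rpow_le_rpow_of_exponent_le (by norm_num) (by linarith)
      _ = 2 := by norm_num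
  calc rectIncrement p x u v ≤ p * ((p - 1) * u * (x / 2) ^ (p - 2)) * v := h
    _ = p * (p - 1) * (u * v) * (x / 2) ^ (p - 2) := by ring
    _ ≤ p * 1 * (u * v) * (2 * x ^ (p - 2)) := by
        have : 0 < x / 2 := by linarith
        gcongr
        linarith
    _ = 2 * p * (u * v * x ^ (p - 2)) := by ring

/-- For `p = 2H` this is the symmetry of the covariance when the two time intervals are exchanged.
-/
lemma rectIncrement_symm (p x u v : ℝ) : rectIncrement p (-x) v u = rectIncrement p x u v := by
  rw [rectIncrement, rectIncrement, abs_neg, ← abs_neg (-x + u), ← abs_neg (-x + u - v),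
    ← abs_neg (-x - v)]
  ring_nf

/-- Two regimes: if `x` dominates both lengths the derivative is small by decay; otherwise the
longer interval fixes the scale and the Hölder bound, taken in its length, already has the right
form. -/
lemma rectIncrement_le {p x u v : ℝ} (hp : 1 < p) (hp2 : p ≤ 2) (hx : 0 < x)
    (hu : 0 < u) (hv : 0 < v) :
    rectIncrement p x u v ≤ 4 * p * (u * v * (max x (max u v)) ^ (p - 2)) := by
  -- Any scale within a factor two of the maximum may replace it, since `2 ^ (p - 2) ≥ 1 / 2`.
  have key : ∀ w, 0 < w → w ≤ max x (max u v) → max x (max u v) ≤ 2 * w →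
      w ^ (p - 2) ≤ 2 * (max x (max u v)) ^ (p - 2) := by
    intro w hw _ h2
    have h3 : (2 * w) ^ (p - 2) ≤ (max x (max u v)) ^ (p - 2) :=
      Real.rpow_le_rpow_of_nonpos (by positivity) h2 (by linarith)
    rw [Real.mul_rpow (by norm_num) hw.le] at h3
    have h4 : (1 / 2 : ℝ) ≤ 2 ^ (p - 2) := by
      calc (1 / 2 : ℝ) = 2 ^ (-1 : ℝ) := by rw [Real.rpow_neg_one]; norm_num
        _ ≤ 2 ^ (p - 2) := Real.rpow_le_rpow_of_exponent_le (by norm_num) (by linarith)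
    nlinarith [Real.rpow_nonneg hw.le (p - 2)]
  have hfin : ∀ w, 0 < w → w ≤ max x (max u v) → max x (max u v) ≤ 2 * w →
      rectIncrement p x u v ≤ 2 * p * (u * v * w ^ (p - 2)) →
      rectIncrement p x u v ≤ 4 * p * (u * v * (max x (max u v)) ^ (p - 2)) := by
    intro w hw h1 h2 h3
    have h4 := mul_le_mul_of_nonneg_left (key w hw h1 h2) (by positivity : 0 ≤ 2 * p * (u * v))
    linarith
  by_cases hmax : 2 * max u v ≤ x
  · have hux : 2 * u ≤ x := le_trans (by linarith [le_max_left u v]) hmax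
    refine hfin x hx (le_max_left _ _) (max_le (by linarith) (by
      have : 0 < max u v := lt_max_of_lt_left hu
      linarith)) (rectIncrement_le_of_two_mul_le hp hp2 hx hu.le hv.le hux)
  · push Not at hmax
    have hM : 0 < max u v := lt_max_of_lt_left hu
    refine hfin (max u v) hM (le_max_right _ _) (max_le hmax.le (by linarith)) ?_
    have hpow : ∀ a : ℝ, 0 < a → a ^ (p - 1) = a ^ (p - 2) * a := by
      intro a ha
      rw [← Real.rpow_add_one ha.ne']
      ring_nf
    -- The Hölder exponent must fall on the longer interval, so the intervals are exchanged when `u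
    -- ≤ v`.
    rcases le_total u v with h | h
    · rw [max_eq_right h, ← rectIncrement_symm]
      refine (rectIncrement_le_holder hp hp2 (-x) hv.le hu.le).trans_eq ?_
      rw [hpow v hv]
      ring
    · rw [max_eq_left h]
      refine (rectIncrement_le_holder hp hp2 x hu.le hv.le).trans_eq ?_
      rw [hpow u hu]
      ring

/-- A bound of product form, of the homogeneity of `rectIncrement p`. -/
lemma rectIncrement_le_prod {p x u v a b : ℝ} (hp : 1 < p) (hp2 : p ≤ 2) (ha : a ≤ 1) (hb : 0 ≤ b)
    (hab : 2 * a - b = p) (hx : 0 < x) (hu : 0 < u) (hv : 0 < v) :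
    rectIncrement p x u v ≤ 4 * p * ((u * v) ^ a * x ^ (-b)) := by
  refine (rectIncrement_le hp hp2 hx hu hv).trans ?_
  set M := max x (max u v) with hM
  have hxM : x ≤ M := le_max_left _ _
  have huM : u ≤ M := (le_max_left _ _).trans (le_max_right _ _)
  have hvM : v ≤ M := (le_max_right _ _).trans (le_max_right _ _)
  have hM0 : 0 < M := hx.trans_le hxM
  refine mul_le_mul_of_nonneg_left ?_ (by linarith)
  -- Interpolation: part of each length is traded for the maximal scale `M`. The powers of `M` then
  -- add up to `-b ≤ 0`, and `M` can be lowered to `x`.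
  have h1 : ∀ w : ℝ, 0 < w → w ≤ M → w ≤ w ^ a * M ^ (1 - a) := by
    intro w hw hwM
    calc w = w ^ a * w ^ (1 - a) := by rw [← Real.rpow_add hw]; simp
      _ ≤ w ^ a * M ^ (1 - a) := by gcongr
  have h2 : M ^ (-b) ≤ x ^ (-b) := Real.rpow_le_rpow_of_nonpos hx hxM (by linarith)
  calc u * v * M ^ (p - 2)
      ≤ (u ^ a * M ^ (1 - a)) * (v ^ a * M ^ (1 - a)) * M ^ (p - 2) := by
        gcongr
        · exact h1 u hu huM
        · exact h1 v hv hvM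
    _ = (u * v) ^ a * (M ^ (1 - a) * M ^ (1 - a) * M ^ (p - 2)) := by
        rw [Real.mul_rpow hu.le hv.le]; ring
    _ = (u * v) ^ a * M ^ (-b) := by
        rw [← Real.rpow_add hM0, ← Real.rpow_add hM0]
        congr 2
        linarith
    _ ≤ (u * v) ^ a * x ^ (-b) := by gcongr

/-! ### The kernels in the Hilbert space of the fractional Brownian motion -/

/-- The squared distance of two tensor powers expands into `m`-th powers of inner products, which
are continuous and cancel at `h = k`. -/
lemma continuous_symPow {E : Type*} [NormedAddCommGroup E] [InnerProductSpace ℝ E] (m : ℕ) :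
    Continuous (symPow (E := E) m) := by
  rw [continuous_iff_continuousAt]
  intro k
  rw [ContinuousAt, tendsto_iff_norm_sub_tendsto_zero]
  have h1 : ∀ h : E, ‖symPow m h - symPow m k‖ =
      √((inner ℝ h h) ^ m - 2 * (inner ℝ h k) ^ m + (inner ℝ k k) ^ m) := by
    intro h
    rw [← inner_symPow, ← inner_symPow, ← inner_symPow, real_inner_self_eq_norm_sq,
      real_inner_self_eq_norm_sq, ← norm_sub_sq_real, Real.sqrt_sq (norm_nonneg _)]
  simp only [h1]
  have h2 : Continuous fun h : E =>
      √((inner ℝ h h) ^ m - 2 * (inner ℝ h k) ^ m + (inner ℝ k k) ^ m) := by fun_prop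
  refine (h2.tendsto k).trans_eq ?_
  ring_nf
  simp

section

variable {Ω : Type*} [MeasurableSpace Ω] {H : ℝ} {B : ℝ≥0 → Ω → ℝ} {P : Measure Ω}
  (hB : IsFractionalBrownianMotion H B P)

lemma inner_fbmIntegral (h k : FbmHilbert hB) :
    inner ℝ (fbmIntegral hB h) (fbmIntegral hB k) = inner ℝ h k :=
  (LinearMap.norm_map_iff_inner_map_map (𝕜 := ℝ) (fbmIntegral hB)).1 (norm_fbmIntegral hB) h k

lemma inner_toL2 (s t : ℝ≥0) : inner ℝ (hB.toL2 s) (hB.toL2 t) =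
    (1 / 2) * ((s : ℝ) ^ (2 * H) + (t : ℝ) ^ (2 * H) - |(s : ℝ) - t| ^ (2 * H)) := by
  rw [inner_L2_eq, ← hB.covariance]
  refine integral_congr_ae ?_
  filter_upwards [(hB.gaussian.hasGaussianLaw_eval s).memLp_two.coeFn_toLp,
    (hB.gaussian.hasGaussianLaw_eval t).memLp_two.coeFn_toLp] with ω h1 h2
  exact congrArg₂ (· * ·) h1 h2

/-- In the sum of four covariances the powers of single times cancel, and only the powers of
differences survive. -/
lemma inner_fbmIndicator {s₁ t₁ s₂ t₂ : ℝ} (hs₁ : 0 ≤ s₁) (ht₁ : 0 ≤ t₁) (hs₂ : 0 ≤ s₂)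
    (ht₂ : 0 ≤ t₂) :
    inner ℝ (fbmIndicator hB s₁.toNNReal t₁.toNNReal) (fbmIndicator hB s₂.toNNReal t₂.toNNReal) =
      1 / 2 * rectIncrement (2 * H) (s₂ - s₁) (t₁ - s₁) (t₂ - s₂) := by
  rw [← inner_fbmIntegral, fbmIntegral_fbmIndicator, fbmIntegral_fbmIndicator, inner_sub_left,
    inner_sub_right, inner_sub_right]
  simp only [inner_toL2, Real.coe_toNNReal _ hs₁, Real.coe_toNNReal _ hs₂, Real.coe_toNNReal _ ht₁,
    Real.coe_toNNReal _ ht₂, rectIncrement]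
  rw [abs_sub_comm s₁ s₂, abs_sub_comm s₁ t₂, abs_sub_comm t₁ t₂, abs_sub_comm t₁ s₂]
  ring_nf

lemma norm_fbmIndicator_sq (hH : 0 < H) (s t : ℝ≥0) :
    ‖fbmIndicator hB s t‖ ^ 2 = |(t : ℝ) - s| ^ (2 * H) := by
  have h := inner_fbmIndicator hB s.coe_nonneg t.coe_nonneg s.coe_nonneg t.coe_nonneg
  simp only [Real.toNNReal_coe] at h
  rw [← real_inner_self_eq_norm_sq, h, rectIncrement]
  have h0 : 2 * H ≠ 0 := by linarith
  simp [abs_sub_comm (s : ℝ) t, Real.zero_rpow h0]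
  ring

/-- Together with `inner_fbmIndicator` this identifies `μ(s₂ - s₁, t₁ - s₁, t₂ - s₂)` with the inner
product of the two indicators: the increments are stationary. -/
lemma IsFractionalBrownianMotion.muCov_eq (hB : IsFractionalBrownianMotion H B P) {x u₁ u₂ : ℝ} (hx : 0 ≤ x) (hu₁ : 0 ≤ u₁) (hu₂ : 0 ≤ u₂) :
    muCov B P x u₁ u₂ = 1 / 2 * rectIncrement (2 * H) x u₁ u₂ := by
  have hL2 := fun t => (hB.gaussian.hasGaussianLaw_eval t).memLp_two
  simp only [muCov, mul_sub]
  have hi : ∀ s t, Integrable (fun ω => B s ω * B t ω) P := fun s t =>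
    (hL2 s).integrable_mul (hL2 t)
  rw [integral_sub (hi _ _) (hi _ _),
    hB.covariance, hB.covariance, Real.coe_toNNReal _ hx, Real.coe_toNNReal _ hu₁,
    Real.coe_toNNReal _ (add_nonneg hx hu₂), abs_sub_comm u₁, abs_sub_comm u₁, rectIncrement,
    abs_of_nonneg (add_nonneg hx hu₂), abs_of_nonneg hx]
  ring

lemma continuous_fbmIndicator (hH : 0 < H) :
    Continuous fun p : ℝ≥0 × ℝ≥0 => fbmIndicator hB p.1 p.2 := by
  have h1 : Continuous fun t : ℝ≥0 => ((StepFunction.indicator hB t : StepFunction hB) :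
      FbmHilbert hB) := by
    rw [continuous_iff_continuousAt]
    intro s
    rw [ContinuousAt, tendsto_iff_norm_sub_tendsto_zero]
    have h2 : ∀ t : ℝ≥0, ‖((StepFunction.indicator hB t : StepFunction hB) : FbmHilbert hB) -
        ((StepFunction.indicator hB s : StepFunction hB) : FbmHilbert hB)‖ =
        √(|(t : ℝ) - s| ^ (2 * H)) := by
      intro t
      rw [← norm_fbmIndicator_sq hB hH, Real.sqrt_sq (norm_nonneg _), fbmIndicator,
        UniformSpace.Completion.coe_sub]
    simp only [h2]
    have h3 : Continuous fun t : ℝ≥0 => √(|(t : ℝ) - s| ^ (2 * H)) := by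
      have : 0 ≤ 2 * H := by linarith
      exact ((by fun_prop : Continuous fun t : ℝ≥0 => |(t : ℝ) - s|).rpow_const
        fun _ => Or.inr this).sqrt
    refine (h3.tendsto s).trans_eq ?_
    simp [Real.zero_rpow (by linarith : 2 * H ≠ 0)]
  simp only [fbmIndicator, UniformSpace.Completion.coe_sub]
  exact (h1.comp continuous_snd).sub (h1.comp continuous_fst)

lemma inner_smul_symPow {E : Type*} [NormedAddCommGroup E] [InnerProductSpace ℝ E] (m : ℕ)
    (a b : ℝ) (h k : E) :
    inner ℝ (a • symPow m h) (b • symPow m k) = a * b * (inner ℝ h k) ^ m := by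
  refine (real_inner_smul_left (symPow m h) (b • symPow m k) a).trans ?_
  refine (congrArg _ (real_inner_smul_right (symPow m h) (symPow m k) b)).trans ?_
  rw [inner_symPow, mul_assoc]

lemma continuousOn_smul_symPow {X E : Type*} [TopologicalSpace X] [NormedAddCommGroup E]
    [InnerProductSpace ℝ E] (m : ℕ) {s : Set X} {c : X → ℝ} {f : X → E} (hc : ContinuousOn c s)
    (hf : ContinuousOn f s) : ContinuousOn (fun x => c x • symPow m (f x)) s :=
  hc.smul ((continuous_symPow m).comp_continuousOn hf)

/-! ### The covariance kernel of the chaotic components. -/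

lemma isCompact_regionR (T : ℝ) : IsCompact (regionR T) := by
  refine (isCompact_Icc (a := (0 : ℝ)) (b := T)).prod (isCompact_Icc (a := (0 : ℝ)) (b := T))
    |>.of_isClosed_subset ?_ ?_
  · exact (isClosed_le continuous_const continuous_fst).inter
      ((isClosed_le continuous_fst continuous_snd).inter
        (isClosed_le continuous_snd continuous_const))
  · rintro p ⟨h1, h2, h3⟩
    exact ⟨⟨h1, h2.trans h3⟩, ⟨h1.trans h2, h3⟩⟩

/-- The scalar factor of the kernel `f_{2q-1,ε,s,t}`. -/
def chaosCoeff (H : ℝ) (q : ℕ) (ε : ℝ) (p : ℝ × ℝ) : ℝ :=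
  (-1) ^ q * betaConst q * (ε + (p.2 - p.1) ^ (2 * H)) ^ (-(q : ℝ) - 1 / 2)

lemma continuousOn_chaosCoeff {H : ℝ} (hH : 0 < H) (T : ℝ) (q : ℕ) {ε : ℝ} (hε : 0 < ε) :
    ContinuousOn (chaosCoeff H q ε) (regionR T) := by
  refine continuousOn_const.mul (ContinuousOn.rpow_const ?_ fun p hp => Or.inl ?_)
  · refine continuousOn_const.add (ContinuousOn.rpow_const (by fun_prop) fun p _ => Or.inr ?_)
    linarith
  · have := Real.rpow_nonneg (sub_nonneg.2 hp.2.1) (2 * H)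
    linarith

/-- For `ε > 0` the singularity on the diagonal `s = t` is absent, so continuity on the compact `𝓡`
gives absolute convergence of the vector-valued integral. -/
lemma continuousOn_chaosKernelAt (hH : 0 < H) (T : ℝ) (q : ℕ) {ε : ℝ} (hε : 0 < ε) :
    ContinuousOn (fun p : ℝ × ℝ => chaosKernelAt hB q ε p.1 p.2) (regionR T) := by
  exact continuousOn_smul_symPow (2 * q - 1) (continuousOn_chaosCoeff hH T q hε)
    ((continuous_fbmIndicator hB hH).comp (by fun_prop :
      Continuous fun p : ℝ × ℝ => (p.1.toNNReal, p.2.toNNReal))).continuousOn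

lemma integrableOn_chaosKernelAt (hH : 0 < H) (T : ℝ) (q : ℕ) {ε : ℝ} (hε : 0 < ε) :
    IntegrableOn (fun p : ℝ × ℝ => chaosKernelAt hB q ε p.1 p.2) (regionR T) :=
  (continuousOn_chaosKernelAt hB hH T q hε).integrableOn_compact (isCompact_regionR T)

/-- The kernel whose integral over `𝓡 × 𝓡` is the inner product of `f_{2q-1,ε}` and
`f_{2q-1,η}`. -/
def covKernel (H : ℝ) (q : ℕ) (ε η : ℝ) (z : (ℝ × ℝ) × (ℝ × ℝ)) : ℝ :=
  chaosCoeff H q ε z.1 * chaosCoeff H q η z.2 *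
    (1 / 2 * rectIncrement (2 * H) (z.2.1 - z.1.1) (z.1.2 - z.1.1) (z.2.2 - z.2.1)) ^ (2 * q - 1)

lemma inner_chaosKernelAt (q : ℕ) (ε η : ℝ) {T : ℝ} {p p' : ℝ × ℝ} (hp : p ∈ regionR T)
    (hp' : p' ∈ regionR T) :
    inner ℝ (chaosKernelAt hB q ε p.1 p.2) (chaosKernelAt hB q η p'.1 p'.2) =
      covKernel H q ε η (p, p') := by
  refine (inner_smul_symPow (2 * q - 1) (chaosCoeff H q ε p) (chaosCoeff H q η p') _ _).trans ?_
  rw [inner_fbmIndicator hB hp.1 (hp.1.trans hp.2.1) hp'.1 (hp'.1.trans hp'.2.1)]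
  rfl

lemma continuous_rectIncrement {X : Type*} [TopologicalSpace X] {p : ℝ} (hp : 0 ≤ p)
    {f g h : X → ℝ} (hf : Continuous f) (hg : Continuous g) (hh : Continuous h) :
    Continuous fun x => rectIncrement p (f x) (g x) (h x) := by
  have : ∀ k : X → ℝ, Continuous k → Continuous fun x => |k x| ^ p := fun k hk =>
    hk.abs.rpow_const fun _ => Or.inr hp
  exact (((this _ (hf.add hh)).sub (this _ hf)).sub (this _ ((hf.add hh).sub hg))).add
    (this _ (hf.sub hg))

lemma continuousOn_covKernel {H : ℝ} (hH : 0 < H) (T : ℝ) (q : ℕ) {ε η : ℝ} (hε : 0 < ε)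
    (hη : 0 < η) : ContinuousOn (covKernel H q ε η) (regionR T ×ˢ regionR T) := by
  refine ContinuousOn.mul (ContinuousOn.mul ?_ ?_) (Continuous.continuousOn ?_)
  · exact (continuousOn_chaosCoeff hH T q hε).comp continuousOn_fst fun z hz => hz.1
  · exact (continuousOn_chaosCoeff hH T q hη).comp continuousOn_snd fun z hz => hz.2
  · refine (continuous_const.mul (continuous_rectIncrement ?_ ?_ ?_ ?_)).pow _
    · linarith
    all_goals fun_prop

/-- The inner product passes through both vector-valued integrals, and the iterated integral is then
a double one by Fubini. -/
lemma inner_chaosKernel (hH : 0 < H) (T : ℝ) (q : ℕ) {ε η : ℝ} (hε : 0 < ε) (hη : 0 < η) :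
    inner ℝ (chaosKernel hB T q ε) (chaosKernel hB T q η) =
      ∫ z in regionR T ×ˢ regionR T, covKernel H q ε η z := by
  have hm := (isCompact_regionR T).measurableSet
  have hi : IntegrableOn (covKernel H q ε η) (regionR T ×ˢ regionR T) :=
    (continuousOn_covKernel hH T q hε hη).integrableOn_compact
      ((isCompact_regionR T).prod (isCompact_regionR T))
  rw [Measure.volume_eq_prod, setIntegral_prod _ hi, real_inner_comm]
  conv_lhs => rw [chaosKernel.eq_1 hB T q ε]
  rw [← integral_inner (integrableOn_chaosKernelAt hB hH T q hε)]
  refine setIntegral_congr_fun hm fun p hp => ?_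
  rw [real_inner_comm, chaosKernel, ← integral_inner (integrableOn_chaosKernelAt hB hH T q hη)]
  exact setIntegral_congr_fun hm fun p' hp' => inner_chaosKernelAt hB q ε η hp hp'

/-- Polarisation of the norm identity. -/
lemma inner_multipleIntegral (m : ℕ) (f g : SymTensorPower (FbmHilbert hB) m) :
    inner ℝ (multipleIntegral hB m f) (multipleIntegral hB m g) =
      (m.factorial : ℝ) * inner ℝ f g := by
  have h := norm_multipleIntegral hB m
  have h2 : √(m.factorial : ℝ) ^ 2 = m.factorial := Real.sq_sqrt (by positivity)
  rw [real_inner_eq_norm_add_mul_self_sub_norm_mul_self_sub_norm_mul_self_div_two,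
    real_inner_eq_norm_add_mul_self_sub_norm_mul_self_sub_norm_mul_self_div_two f g, ← map_add,
    h, h, h]
  linear_combination ((‖f + g‖ ^ 2 - ‖f‖ ^ 2 - ‖g‖ ^ 2) / 2) * h2

lemma inner_chaosComponent (hH : 0 < H) (T : ℝ) (q : ℕ) {ε η : ℝ} (hε : 0 < ε) (hη : 0 < η) :
    inner ℝ (chaosComponent hB T q ε) (chaosComponent hB T q η) =
      ((2 * q - 1).factorial : ℝ) * ∫ z in regionR T ×ˢ regionR T, covKernel H q ε η z := by
  rw [← inner_chaosKernel hB hH T q hε hη]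
  exact inner_multipleIntegral hB _ _ _

end

/-! ### Gaussian integrals of the derivative of the heat kernel -/

lemma hasDerivAt_heatKernel {ε : ℝ} (hε : 0 < ε) (x : ℝ) :
    HasDerivAt (heatKernel ε) (-(x / ε) * heatKernel ε x) x := by
  have h : HasDerivAt (fun x : ℝ => -x ^ 2 / (2 * ε)) (-(x / ε)) x := by
    refine (((hasDerivAt_id x).pow 2).neg.div_const (2 * ε)).congr_deriv ?_
    simp
    field_simp
  refine (h.exp.const_mul ((2 * Real.pi * ε) ^ (-(1 / 2) : ℝ))).congr_deriv ?_
  rw [heatKernel]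
  ring

lemma deriv_heatKernel {ε : ℝ} (hε : 0 < ε) :
    deriv (heatKernel ε) = fun x => -(x / ε) * heatKernel ε x :=
  funext fun x => (hasDerivAt_heatKernel hε x).deriv

lemma continuous_deriv_heatKernel {ε : ℝ} (hε : 0 < ε) : Continuous (deriv (heatKernel ε)) := by
  rw [deriv_heatKernel hε]
  unfold heatKernel
  fun_prop

lemma exists_bound_deriv_heatKernel {ε : ℝ} (hε : 0 < ε) :
    ∃ C, ∀ x, ‖deriv (heatKernel ε) x‖ ≤ C := by
  refine ⟨(2 * Real.pi * ε) ^ (-(1 / 2) : ℝ) * (1 / ε + 1), fun x => ?_⟩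
  have hc : 0 ≤ (2 * Real.pi * ε) ^ (-(1 / 2) : ℝ) := by positivity
  -- The constant comes from `|x| ≤ (x² + 1) / 2` and `1 + y ≤ exp y` with `y = x² / (2ε)`.
  have h1 : |x / ε| * Real.exp (-x ^ 2 / (2 * ε)) ≤ 1 / ε + 1 := by
    have h2 : |x / ε| ≤ (1 / ε + 1) * Real.exp (x ^ 2 / (2 * ε)) := by
      have h3 := Real.add_one_le_exp (x ^ 2 / (2 * ε))
      have h4 : |x / ε| ≤ (1 / ε + 1) * (x ^ 2 / (2 * ε) + 1) := by
        rw [abs_div, abs_of_pos hε]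
        have h5 : |x| ≤ (x ^ 2 + 1) / 2 := by nlinarith [sq_abs x, sq_nonneg (|x| - 1)]
        calc |x| / ε ≤ ((x ^ 2 + 1) / 2) / ε := by gcongr
          _ ≤ (1 / ε + 1) * (x ^ 2 / (2 * ε) + 1) := by
            have h6 : (1 / ε + 1) * (x ^ 2 / (2 * ε) + 1) - ((x ^ 2 + 1) / 2) / ε =
              (x ^ 2 / (2 * ε)) / ε + 1 / (2 * ε) + 1 := by field_simp; ring
            have : 0 ≤ (x ^ 2 / (2 * ε)) / ε + 1 / (2 * ε) + 1 := by positivity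
            linarith
      refine h4.trans ?_
      gcongr
    calc |x / ε| * Real.exp (-x ^ 2 / (2 * ε))
        ≤ (1 / ε + 1) * Real.exp (x ^ 2 / (2 * ε)) * Real.exp (-x ^ 2 / (2 * ε)) := by gcongr
      _ = 1 / ε + 1 := by
        rw [mul_assoc, ← Real.exp_add, neg_div, add_neg_cancel, Real.exp_zero, mul_one]
  simp only [deriv_heatKernel hε, heatKernel]
  rw [Real.norm_eq_abs, abs_mul, abs_neg, abs_mul,
    abs_of_nonneg hc, abs_of_pos (Real.exp_pos _)]
  calc |x / ε| * ((2 * Real.pi * ε) ^ (-(1 / 2) : ℝ) * Real.exp (-x ^ 2 / (2 * ε)))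
      = (2 * Real.pi * ε) ^ (-(1 / 2) : ℝ) * (|x / ε| * Real.exp (-x ^ 2 / (2 * ε))) := by ring
    _ ≤ _ := by gcongr

/-- The exponents add: precision `1` from the Gaussian density and `σ² / ε` from the heat kernel
give precision `1 / v`. The heat kernel is thus absorbed into a change of variance. -/
lemma heatKernel_mul_gaussianPDFReal {ε : ℝ} (hε : 0 < ε) (σ x : ℝ) (v : ℝ≥0)
    (hv : (v : ℝ) = ε / (ε + σ ^ 2)) :
    gaussianPDFReal 0 1 x * heatKernel ε (σ * x) =
      (2 * Real.pi * ε) ^ (-(1 / 2) : ℝ) * √v * gaussianPDFReal 0 v x := by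
  have hS : 0 < ε + σ ^ 2 := by positivity
  have hv0 : 0 < (v : ℝ) := by rw [hv]; positivity
  rw [gaussianPDFReal, gaussianPDFReal, heatKernel, Real.sqrt_mul (by positivity) (v : ℝ)]
  have hexp : Real.exp (-(x - 0) ^ 2 / (2 * (1 : ℝ≥0))) * Real.exp (-(σ * x) ^ 2 / (2 * ε)) =
      Real.exp (-(x - 0) ^ 2 / (2 * v)) := by
    rw [← Real.exp_add, hv]
    congr 1
    simp
    field_simp
    ring
  rw [← hexp]
  have := (Real.sqrt_pos.2 hv0).ne'
  simp
  field_simp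

open Nat in
lemma eval_hermiteReal_two_mul_zero (n : ℕ) :
    (hermiteReal (2 * n)).eval 0 = (-1) ^ n * ((2 * n - 1)‼ : ℝ) := by
  rw [← Polynomial.coeff_zero_eq_eval_zero, hermiteReal, Polynomial.coeff_map]
  have h := Polynomial.coeff_hermite_explicit n 0
  rw [add_zero] at h
  rw [h]
  simp

open Nat in
lemma factorial_two_mul_add_one (n : ℕ) :
    ((2 * n + 1)! : ℝ) = (2 * n + 1) * ((2 * n - 1)‼ : ℝ) * (2 ^ n * (n ! : ℝ)) := by
  have h : (2 * n + 1)! = (2 * n + 1) * (2 * n - 1)‼ * (2 ^ n * n !) := by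
    rw [Nat.factorial_eq_mul_doubleFactorial, Nat.doubleFactorial_two_mul,
      Nat.doubleFactorial_add_one]
  rw [h]
  push_cast
  ring

/-- After the change of variance, the factor `x` of `p_ε'` is removed by Gaussian integration by
parts. This lowers the Hermite index to an even one, whose mean under variance `v` is explicit. -/
lemma integral_deriv_heatKernel_mul_hermiteReal {ε : ℝ} (hε : 0 < ε) (σ : ℝ) {q : ℕ}
    (hq : 1 ≤ q) :
    ∫ x, deriv (heatKernel ε) (σ * x) * (hermiteReal (2 * q - 1)).eval x ∂(gaussianReal 0 1) =
      ((2 * q - 1).factorial : ℝ) *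
        ((-1) ^ q * betaConst q * (ε + σ ^ 2) ^ (-(q : ℝ) - 1 / 2)) * σ ^ (2 * q - 1) := by
  obtain ⟨n, rfl⟩ := Nat.exists_eq_add_of_le' hq
  have hm : 2 * (n + 1) - 1 = 2 * n + 1 := by omega
  rw [hm]
  have hS : 0 < ε + σ ^ 2 := by positivity
  set v : ℝ≥0 := ⟨ε / (ε + σ ^ 2), by positivity⟩ with hv
  have hvr : (v : ℝ) = ε / (ε + σ ^ 2) := rfl
  have hv0 : v ≠ 0 := by
    rw [← NNReal.coe_ne_zero, hvr]; positivity
  set K : ℝ := (2 * Real.pi * ε) ^ (-(1 / 2) : ℝ) * √v with hK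
  have h1 : ∫ x, deriv (heatKernel ε) (σ * x) * (hermiteReal (2 * n + 1)).eval x
      ∂(gaussianReal 0 1) =
      -(σ / ε) * K * ∫ x, x * (hermiteReal (2 * n + 1)).eval x ∂(gaussianReal 0 v) := by
    rw [integral_gaussianReal_eq_integral_smul one_ne_zero,
      integral_gaussianReal_eq_integral_smul hv0, ← integral_const_mul]
    refine integral_congr_ae (ae_of_all _ fun x => ?_)
    have := heatKernel_mul_gaussianPDFReal hε σ x v hvr
    simp only [smul_eq_mul, deriv_heatKernel hε]
    rw [hK]
    linear_combination (-(σ * x / ε) * (hermiteReal (2 * n + 1)).eval x) * this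
  have h2 : ∫ x, (hermiteReal (2 * n)).eval x ∂(gaussianReal 0 v) =
      (σ ^ 2 / (ε + σ ^ 2)) ^ n * ((-1) ^ n * ((2 * n - 1).doubleFactorial : ℝ)) := by
    -- The shift formula at `x = 0` with `ρ² = σ² / (ε + σ²) = 1 - v`: the mean is `ρ^(2n)
    -- H_{2n}(0)`.
    have h := integral_hermiteReal_add (σ / √(ε + σ ^ 2)) v (by
      rw [hvr, div_pow, Real.sq_sqrt hS.le]; field_simp; ring) (2 * n) 0
    simp only [mul_zero, zero_add] at h
    rw [h, eval_hermiteReal_two_mul_zero, pow_mul, div_pow, Real.sq_sqrt hS.le]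
  rw [h1, integral_mul_eval_gaussianReal, derivative_hermiteReal_succ]
  simp only [Polynomial.eval_smul, smul_eq_mul, integral_const_mul]
  rw [h2, factorial_two_mul_add_one, betaConst, hK, hvr, Real.sqrt_div hε.le]
  have e1 : (2 * Real.pi * ε) ^ (-(1 / 2) : ℝ) = (√2 * √Real.pi * √ε)⁻¹ := by
    rw [Real.rpow_neg (by positivity), ← Real.sqrt_eq_rpow, Real.sqrt_mul (by positivity),
      Real.sqrt_mul (by positivity)]
  have e2 : (ε + σ ^ 2) ^ (-((n + 1 : ℕ) : ℝ) - 1 / 2) =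
      ((ε + σ ^ 2) ^ (n + 1) * √(ε + σ ^ 2))⁻¹ := by
    rw [← neg_add', Real.rpow_neg hS.le, Real.rpow_add hS, Real.rpow_natCast, ← Real.sqrt_eq_rpow]
  have e3 : (2 : ℝ) ^ (((n + 1 : ℕ) : ℝ) - 1 / 2) = 2 ^ n * √2 := by
    rw [Real.sqrt_eq_rpow, ← Real.rpow_natCast, ← Real.rpow_add (by norm_num)]
    congr 1
    push_cast
    ring
  rw [e1, e2, e3, Nat.add_sub_cancel]
  have hs1 := Real.sqrt_pos.2 hS
  have hs2 := Real.sqrt_pos.2 hε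
  have hs3 := Real.sqrt_pos.2 Real.pi_pos
  have hs4 : 0 < √(2 : ℝ) := by positivity
  have hf : (n.factorial : ℝ) ≠ 0 := by positivity
  rw [div_pow]
  push_cast
  field_simp
  ring

section

variable {Ω : Type*} [MeasurableSpace Ω] {H : ℝ} {B : ℝ≥0 → Ω → ℝ} {P : Measure Ω}
  (hB : IsFractionalBrownianMotion H B P)

/-! ### Hermite coefficients of `p_ε'(B(k))`. -/

lemma integral_fbmIntegral (h : FbmHilbert hB) : ∫ ω, fbmIntegral hB h ω ∂P = 0 := by
  have h1 := integral_map (f := fun x : ℝ => x)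
    (Lp.aestronglyMeasurable (fbmIntegral hB h)).aemeasurable (by fun_prop)
  rw [map_fbmIntegral, integral_id_gaussianReal] at h1
  exact h1.symm

lemma map_fbmIntegral_pair {h k : FbmHilbert hB} (hhk : inner ℝ h k = 0) :
    P.map (fun ω => (fbmIntegral hB h ω, fbmIntegral hB k ω)) =
      (gaussianReal 0 (‖h‖₊ ^ 2)).prod (gaussianReal 0 (‖k‖₊ ^ 2)) := by
  have := isProbabilityMeasure_of_fbm hB
  have hind : IndepFun (fbmIntegral hB h) (fbmIntegral hB k) P := by
    refine (hasGaussianLaw_fbmIntegral_pair hB h k).indepFun_of_covariance_eq_zero ?_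
    rw [covariance_eq_sub (Lp.memLp _) (Lp.memLp _), integral_fbmIntegral, integral_fbmIntegral,
      mul_zero, sub_zero]
    refine Eq.trans ?_ ((inner_L2_eq _ _).symm.trans ((inner_fbmIntegral hB h k).trans hhk))
    rfl
  rw [(indepFun_iff_map_prod_eq_prod_map_map (Lp.aestronglyMeasurable _).aemeasurable
    (Lp.aestronglyMeasurable _).aemeasurable).1 hind, map_fbmIntegral, map_fbmIntegral]

/-- `𝔼[p_ε'(B(k)) H_{2q-1}(B(h))]` for a unit vector `h`. -/
lemma integral_deriv_heatKernel_mul_hermite {ε : ℝ} (hε : 0 < ε) {q : ℕ} (hq : 1 ≤ q)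
    (k : FbmHilbert hB) {h : FbmHilbert hB} (hh : ‖h‖ = 1) :
    ∫ ω, deriv (heatKernel ε) (fbmIntegral hB k ω) *
        (hermiteReal (2 * q - 1)).eval (fbmIntegral hB h ω) ∂P =
      ((2 * q - 1).factorial : ℝ) *
        ((-1) ^ q * betaConst q * (ε + ‖k‖ ^ 2) ^ (-(q : ℝ) - 1 / 2)) *
        (inner ℝ k h) ^ (2 * q - 1) := by
  have := isProbabilityMeasure_of_fbm hB
  -- A zero vector has no direction to normalise; both sides vanish, since `p_ε'(0) = 0` and `2q -
  -- 1` is positive.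
  by_cases hk : k = 0
  · have h0 : 2 * q - 1 ≠ 0 := by omega
    subst hk
    rw [inner_zero_left, zero_pow h0, mul_zero]
    refine integral_eq_zero_of_ae ?_
    rw [map_zero]
    filter_upwards [Lp.coeFn_zero ℝ 2 P] with ω hω
    rw [hω, deriv_heatKernel hε]
    simp
  set σ := ‖k‖ with hσ
  have hσ0 : 0 < σ := norm_pos_iff.2 hk
  -- With `k = σe` and `h = ρe + l`, `l ⊥ e`, the variables `B(e)` and `B(l)` are independent.
  -- Averaging over `B(l)`, whose variance is `1 - ρ²` because `‖h‖ = 1`, turns `H_m(B(h))` into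
  -- `ρ^m H_m(B(e))` and leaves a one-dimensional integral.
  set e : FbmHilbert hB := σ⁻¹ • k with he
  have hen : ‖e‖ = 1 := by
    rw [he, norm_smul, norm_inv, Real.norm_of_nonneg hσ0.le, ← hσ, inv_mul_cancel₀ hσ0.ne']
  set ρ : ℝ := inner ℝ e h with hρ
  set l : FbmHilbert hB := h - ρ • e with hl
  have hlsq : ‖l‖ ^ 2 = 1 - ρ ^ 2 := by
    rw [hl, norm_sub_sq_real, norm_smul, real_inner_smul_right, real_inner_comm, hh, hen, ← hρ,
      mul_one, Real.norm_eq_abs, sq_abs]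
    ring
  have hel : inner ℝ e l = 0 := by
    rw [hl, inner_sub_right, real_inner_smul_right, real_inner_self_eq_norm_sq, hen, ← hρ]
    ring
  have hlaw := map_fbmIntegral_pair hB hel
  have hen' : ‖e‖₊ ^ 2 = 1 := NNReal.eq (by simp [hen])
  rw [hen'] at hlaw
  set X := fbmIntegral hB e with hX
  set Z := fbmIntegral hB l with hZ
  have hXm := (Lp.aestronglyMeasurable X).aemeasurable
  have hZm := (Lp.aestronglyMeasurable Z).aemeasurable
  have hYae : (fbmIntegral hB h : Ω → ℝ) =ᵐ[P] fun ω => ρ * X ω + Z ω := by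
    have : fbmIntegral hB h = ρ • X + Z := by
      rw [hX, hZ, hl, ← map_smul, ← map_add, add_sub_cancel]
    rw [this]
    filter_upwards [Lp.coeFn_add (ρ • X) Z, Lp.coeFn_smul ρ X] with ω h1 h2
    rw [h1, Pi.add_apply, h2]; rfl
  have hkae : (fbmIntegral hB k : Ω → ℝ) =ᵐ[P] fun ω => σ * X ω := by
    have : fbmIntegral hB k = σ • X := by
      rw [hX, he, map_smul, smul_inv_smul₀ hσ0.ne']
    rw [this]
    exact Lp.coeFn_smul σ X
  have hcont := continuous_deriv_heatKernel hε
  obtain ⟨C, hC⟩ := exists_bound_deriv_heatKernel hε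
  set m := 2 * q - 1 with hm
  have hmeas : Measurable fun p : ℝ × ℝ =>
      deriv (heatKernel ε) (σ * p.1) * (hermiteReal m).eval (ρ * p.1 + p.2) :=
    (hcont.measurable.comp (by fun_prop)).mul (by fun_prop)
  calc ∫ ω, deriv (heatKernel ε) (fbmIntegral hB k ω) *
        (hermiteReal m).eval (fbmIntegral hB h ω) ∂P
      = ∫ ω, (fun p : ℝ × ℝ =>
          deriv (heatKernel ε) (σ * p.1) * (hermiteReal m).eval (ρ * p.1 + p.2))
          (X ω, Z ω) ∂P := by
        refine integral_congr_ae ?_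
        filter_upwards [hYae, hkae] with ω h1 h2
        rw [h1, h2]
    _ = ∫ p, deriv (heatKernel ε) (σ * p.1) * (hermiteReal m).eval (ρ * p.1 + p.2)
          ∂((gaussianReal 0 1).prod (gaussianReal 0 (‖l‖₊ ^ 2))) := by
        rw [← hlaw, integral_map (by fun_prop) hmeas.aestronglyMeasurable]
    _ = ∫ x, ∫ z, deriv (heatKernel ε) (σ * x) * (hermiteReal m).eval (ρ * x + z)
          ∂(gaussianReal 0 (‖l‖₊ ^ 2)) ∂(gaussianReal 0 1) := by
        refine integral_prod _ ?_
        have h2 : Integrable (fun ω => (hermiteReal m).eval (ρ * X ω + Z ω)) P :=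
          ((memLp_hermite hB m h).ae_eq (by filter_upwards [hYae] with ω hω; rw [hω])).integrable
            one_le_two
        rw [← hlaw, integrable_map_measure hmeas.aestronglyMeasurable (by fun_prop)]
        refine h2.bdd_mul (c := C) ?_ (ae_of_all _ fun ω => hC _)
        exact (hcont.measurable.comp_aemeasurable (hXm.const_mul σ)).aestronglyMeasurable
    _ = ∫ x, ρ ^ m * (deriv (heatKernel ε) (σ * x) * (hermiteReal m).eval x)
          ∂(gaussianReal 0 1) := by
        refine integral_congr_ae (ae_of_all _ fun x => ?_)
        simp only
        rw [integral_const_mul, integral_hermiteReal_add ρ _ (by simpa using hlsq)]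
        ring
    _ = _ := by
        rw [integral_const_mul, integral_deriv_heatKernel_mul_hermiteReal hε σ hq]
        have hk' : inner ℝ k h = ρ * σ := by
          rw [hρ, he, real_inner_smul_left]; field_simp
        rw [hk', mul_pow]
        ring

/-! ### The projection of `α_ε` on the chaos -/

lemma multipleIntegral_symPow_eq_wienerPow (m : ℕ) (h : FbmHilbert hB) :
    multipleIntegral hB m (symPow m h) = wienerPow hB m h := by
  have h1 := LinearMap.extendOfNorm_eq (f := Finsupp.linearCombination ℝ (wienerPow hB m))
    (denseRange_symPow m) ⟨√(m.factorial : ℝ), fun a =>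
      (norm_linearCombination_eq (by positivity) (inner_wienerPow hB m) a).le⟩
    (Finsupp.single h 1)
  simp only [Finsupp.linearCombination_single, one_smul] at h1
  rw [multipleIntegral, h1]

lemma wienerPow_mem_wienerChaos {m : ℕ} (hm : m ≠ 0) (h : FbmHilbert hB) :
    wienerPow hB m h ∈ wienerChaos hB m := by
  by_cases hh : h = 0
  · simp [wienerPow, hh, hm]
  · refine Submodule.smul_mem _ _ (Submodule.le_topologicalClosure _ (Submodule.subset_span
      ⟨_, ?_, rfl⟩))
    rw [norm_smul, norm_inv, norm_norm, inv_mul_cancel₀ (norm_ne_zero_iff.2 hh)]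

/-- The chaos is closed and the combinations of tensors `h^{⊗m}` are dense, so their images suffice.
-/
lemma multipleIntegral_mem_wienerChaos {m : ℕ} (hm : m ≠ 0)
    (f : SymTensorPower (FbmHilbert hB) m) : multipleIntegral hB m f ∈ wienerChaos hB m := by
  refine (denseRange_symPow m).induction_on f ?_ fun a => ?_
  · exact (Submodule.isClosed_topologicalClosure _).preimage (multipleIntegral hB m).continuous
  · rw [Finsupp.linearCombination_apply, Finsupp.sum, map_sum]
    refine Submodule.sum_mem _ fun h _ => ?_
    rw [map_smul, multipleIntegral_symPow_eq_wienerPow]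
    exact Submodule.smul_mem _ _ (wienerPow_mem_wienerChaos hB hm h)

lemma inner_chaosComponent_hermiteL2 (hH : 0 < H) (T : ℝ) {q : ℕ} {ε : ℝ} (hε : 0 < ε)
    {h : FbmHilbert hB} (hh : ‖h‖ = 1) :
    inner ℝ (chaosComponent hB T q ε) (hermiteL2 hB (2 * q - 1) h) =
      ∫ p in regionR T, ((2 * q - 1).factorial : ℝ) * chaosCoeff H q ε p *
        (inner ℝ (fbmIndicator hB p.1.toNNReal p.2.toNNReal) h) ^ (2 * q - 1) := by
  rw [← multipleIntegral_symPow hB _ hh, chaosComponent, inner_multipleIntegral, real_inner_comm,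
    chaosKernel, ← integral_inner (integrableOn_chaosKernelAt hB hH T q hε), ← integral_const_mul]
  refine integral_congr_ae (ae_of_all _ fun p => ?_)
  simp only
  rw [mul_assoc]
  congr 1
  rw [real_inner_comm]
  have := inner_smul_symPow (2 * q - 1) (chaosCoeff H q ε p) 1
    (fbmIndicator hB p.1.toNNReal p.2.toNNReal) h
  rw [one_smul, mul_one] at this
  exact this

lemma intervalIntegral_eq_setIntegral_regionR {T : ℝ} (hT : 0 ≤ T) {g : ℝ × ℝ → ℝ}
    (hg : IntegrableOn g (regionR T)) :
    ∫ t in (0 : ℝ)..T, ∫ s in (0 : ℝ)..t, g (s, t) = ∫ p in regionR T, g p := by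
  have hm := (isCompact_regionR T).measurableSet
  have h2 := integral_prod_symm _ ((integrable_indicator_iff hm).2 hg)
  rw [← integral_indicator hm, Measure.volume_eq_prod, h2,
    intervalIntegral.integral_of_le hT, ← integral_Icc_eq_integral_Ioc,
    ← integral_indicator measurableSet_Icc]
  congr 1
  ext t
  by_cases ht : t ∈ Set.Icc 0 T
  · rw [Set.indicator_of_mem ht, intervalIntegral.integral_of_le ht.1,
      ← integral_Icc_eq_integral_Ioc, ← integral_indicator measurableSet_Icc]
    congr 1
    ext s
    simp only [Set.indicator, regionR, Set.mem_ofPred_eq, Set.mem_Icc]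
    simp [ht.2]
  · rw [Set.indicator_of_notMem ht, eq_comm]
    refine integral_eq_zero_of_ae (ae_of_all _ fun s => Set.indicator_of_notMem ?_ _)
    rintro ⟨h1, h3, h4⟩
    exact ht ⟨h1.trans h3, h4⟩

/-- Joint measurability is known on `[0,T] × Ω` only up to null sets; it transfers to the two time
coordinates because projections pull null sets back to null sets and `𝓡 ⊆ [0,T]²`. -/
lemma aestronglyMeasurable_increment [SFinite P] {T : ℝ}
    (hmeas : AEStronglyMeasurable (fun p : ℝ × Ω => B p.1.toNNReal p.2)
      ((volume.restrict (Set.Icc 0 T)).prod P)) :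
    AEStronglyMeasurable (fun z : (ℝ × ℝ) × Ω => B z.1.2.toNNReal z.2 - B z.1.1.toNNReal z.2)
      ((volume.restrict (regionR T)).prod P) := by
  set μ := (volume : Measure ℝ).restrict (Set.Icc 0 T) with hμ
  have h1 := hmeas.comp_quasiMeasurePreserving (QuasiMeasurePreserving.prodMap
    (Measure.quasiMeasurePreserving_fst (μ := μ) (ν := μ)) (Measure.QuasiMeasurePreserving.id P))
  have h2 := hmeas.comp_quasiMeasurePreserving (QuasiMeasurePreserving.prodMap
    (Measure.quasiMeasurePreserving_snd (μ := μ) (ν := μ)) (Measure.QuasiMeasurePreserving.id P))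
  refine (h2.sub h1).mono_ac (Measure.AbsolutelyContinuous.prod ?_ .rfl)
  rw [hμ, Measure.prod_restrict, ← Measure.volume_eq_prod]
  refine (Measure.restrict_mono_set _ ?_).absolutelyContinuous
  rintro p ⟨h1, h2, h3⟩
  exact ⟨⟨h1, h2.trans h3⟩, ⟨h1.trans h2, h3⟩⟩

lemma fbmIntegral_fbmIndicator_ae (s t : ℝ≥0) :
    (fbmIntegral hB (fbmIndicator hB s t) : Ω → ℝ) =ᵐ[P] fun ω => B t ω - B s ω := by
  rw [fbmIntegral_fbmIndicator]
  filter_upwards [Lp.coeFn_sub (hB.toL2 t) (hB.toL2 s),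
    (hB.gaussian.hasGaussianLaw_eval s).memLp_two.coeFn_toLp,
    (hB.gaussian.hasGaussianLaw_eval t).memLp_two.coeFn_toLp] with ω h1 h2 h3
  rw [h1, Pi.sub_apply]
  exact congrArg₂ (· - ·) h3 h2

/-- The candidate lies in the chaos, so it remains to see that it has the same inner product as
`α_ε` with every generator. -/
lemma starProjection_alphaEps (hH : 0 < H) {T : ℝ} (hT : 0 ≤ T) {q : ℕ} (hq : 1 ≤ q) {ε : ℝ}
    (hε : 0 < ε)
    (hmeas : AEStronglyMeasurable (fun p : ℝ × Ω => B p.1.toNNReal p.2)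
      ((volume.restrict (Set.Icc 0 T)).prod P)) :
    ∃ hα : MemLp (alphaEps B T ε) 2 P,
      (wienerChaos hB (2 * q - 1)).starProjection (hα.toLp _) = chaosComponent hB T q ε := by
  have := isProbabilityMeasure_of_fbm hB
  set μ := (volume : Measure (ℝ × ℝ)).restrict (regionR T) with hμ
  have hfin : IsFiniteMeasure μ := ⟨by
    rw [hμ, Measure.restrict_apply_univ]
    exact (isCompact_regionR T).measure_lt_top⟩
  obtain ⟨C, hC⟩ := exists_bound_deriv_heatKernel hε
  set F : (ℝ × ℝ) × Ω → ℝ := fun z =>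
    deriv (heatKernel ε) (B z.1.2.toNNReal z.2 - B z.1.1.toNNReal z.2) with hF
  have hFm : AEStronglyMeasurable F (μ.prod P) :=
    (continuous_deriv_heatKernel hε).comp_aestronglyMeasurable
      (aestronglyMeasurable_increment hmeas)
  have hFi : Integrable F (μ.prod P) := Integrable.of_bound hFm C (ae_of_all _ fun z => hC _)
  have hαae : ∀ᵐ ω ∂P, alphaEps B T ε ω = ∫ p, F (p, ω) ∂μ := by
    filter_upwards [hFi.prod_left_ae] with ω hω
    exact intervalIntegral_eq_setIntegral_regionR hT hω
  have hαm : AEStronglyMeasurable (alphaEps B T ε) P :=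
    (hFm.prod_swap.integral_prod_right').congr (by
      filter_upwards [hαae] with ω hω
      exact hω.symm)
  have hα : MemLp (alphaEps B T ε) 2 P := by
    refine MemLp.of_bound hαm (C * μ.real Set.univ) ?_
    filter_upwards [hαae] with ω hω
    rw [hω]
    exact norm_integral_le_of_norm_le_const (ae_of_all _ fun p => hC _)
  refine ⟨hα, ?_⟩
  have hq0 : 2 * q - 1 ≠ 0 := by omega
  refine Submodule.eq_starProjection_of_mem_orthogonal
    (multipleIntegral_mem_wienerChaos hB hq0 _) ?_
  -- Orthogonality to the closed span is orthogonality to the span, hence to the generators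
  -- `H_{2q-1}(B(h))`.
  rw [wienerChaos, Submodule.orthogonal_closure, Submodule.mem_orthogonal]
  intro w hw
  induction hw using Submodule.span_induction with
  | zero => exact inner_zero_left _
  | add x y _ _ hx hy => rw [inner_add_left, hx, hy, add_zero]
  | smul a x _ hx => rw [real_inner_smul_left, hx, mul_zero]
  | mem w hw =>
    obtain ⟨h, hh, rfl⟩ := hw
    rw [real_inner_comm, inner_sub_left, sub_eq_zero,
      inner_chaosComponent_hermiteL2 hB hH T hε hh, inner_L2_eq]
    set Y : Ω → ℝ := fun ω => (hermiteReal (2 * q - 1)).eval (fbmIntegral hB h ω) with hY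
    have hYi : Integrable Y P := (memLp_hermite hB _ h).integrable one_le_two
    have hYi2 : Integrable (fun z : (ℝ × ℝ) × Ω => Y z.2) (μ.prod P) := hYi.comp_snd μ
    calc ∫ ω, (hα.toLp _ : Lp ℝ 2 P) ω * hermiteL2 hB (2 * q - 1) h ω ∂P
        = ∫ ω, ∫ p, F (p, ω) * Y ω ∂μ ∂P := by
          refine integral_congr_ae ?_
          filter_upwards [hα.coeFn_toLp, (memLp_hermite hB (2 * q - 1) h).coeFn_toLp, hαae]
            with ω h1 h2 h3
          rw [integral_mul_const, h1, h3, hermiteL2, h2]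
      _ = ∫ p, ∫ ω, F (p, ω) * Y ω ∂P ∂μ := by
          -- Fubini applies because `p_ε'` is bounded, the Hermite variable is integrable and `𝓡`
          -- has finite area.
          refine (integral_integral_swap (f := fun p ω => F (p, ω) * Y ω) ?_).symm
          exact hYi2.bdd_mul (c := C) hFm (ae_of_all _ fun z => hC _)
      _ = _ := by
          refine setIntegral_congr_fun (isCompact_regionR T).measurableSet fun p hp => ?_
          have hnorm : ‖fbmIndicator hB p.1.toNNReal p.2.toNNReal‖ ^ 2 =
              (p.2 - p.1) ^ (2 * H) := by
            rw [norm_fbmIndicator_sq hB hH, Real.coe_toNNReal _ hp.1,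
              Real.coe_toNNReal _ (hp.1.trans hp.2.1), abs_of_nonneg (sub_nonneg.2 hp.2.1)]
          have h1 := integral_deriv_heatKernel_mul_hermite hB hε hq
            (fbmIndicator hB p.1.toNNReal p.2.toNNReal) hh
          rw [hnorm] at h1
          refine Eq.trans (integral_congr_ae ?_) h1
          filter_upwards [fbmIntegral_fbmIndicator_ae hB p.1.toNNReal p.2.toNNReal] with ω hω
          rw [hω]

end

/-! ### Domination of the covariance kernels -/

/-- Of the `2q - 1` factors `m`, three take the decaying bound `hm2` and `2q - 4 ≥ 0` take
Cauchy-Schwarz `hm1`. The exponent of `uv` becomes `-H(2q+1) + H(2q-4) + 11H/3 = -4H/3`, the same as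
that of `x` and independent of `q`. -/
lemma rpow_mul_rpow_mul_pow_le {H u v x m ε η : ℝ} {q : ℕ} (hq : 2 ≤ q) (hu : 0 < u)
    (hv : 0 < v) (hx : 0 < x) (hε : 0 ≤ ε) (hη : 0 ≤ η) (hm : 0 ≤ m) (hm1 : m ≤ (u * v) ^ H)
    (hm2 : m ≤ 4 * H * ((u * v) ^ (11 * H / 9) * x ^ (-(4 * H / 9)))) :
    (ε + u ^ (2 * H)) ^ (-(q : ℝ) - 1 / 2) * (η + v ^ (2 * H)) ^ (-(q : ℝ) - 1 / 2) *
        m ^ (2 * q - 1) ≤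
      (4 * H) ^ 3 * (u ^ (-(4 * H / 3)) * v ^ (-(4 * H / 3)) * x ^ (-(4 * H / 3))) := by
  have hw : 0 < u * v := mul_pos hu hv
  have hneg : -(q : ℝ) - 1 / 2 ≤ 0 := by
    have : (0 : ℝ) ≤ q := Nat.cast_nonneg q
    linarith
  have h1 : ∀ y δ : ℝ, 0 < y → 0 ≤ δ → (δ + y ^ (2 * H)) ^ (-(q : ℝ) - 1 / 2) ≤
      (y ^ (2 * H)) ^ (-(q : ℝ) - 1 / 2) := fun y δ hy hδ =>
    Real.rpow_le_rpow_of_nonpos (Real.rpow_pos_of_pos hy _) (by linarith) hneg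
  obtain ⟨n, rfl⟩ := Nat.exists_eq_add_of_le' hq
  have h2 : m ^ (2 * (n + 2) - 1) ≤ ((u * v) ^ H) ^ (2 * n) *
      (4 * H * ((u * v) ^ (11 * H / 9) * x ^ (-(4 * H / 9)))) ^ 3 := by
    rw [show 2 * (n + 2) - 1 = 2 * n + 3 by omega, pow_add]
    gcongr
  calc (ε + u ^ (2 * H)) ^ (-((n + 2 : ℕ) : ℝ) - 1 / 2) *
        (η + v ^ (2 * H)) ^ (-((n + 2 : ℕ) : ℝ) - 1 / 2) * m ^ (2 * (n + 2) - 1)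
      ≤ (u ^ (2 * H)) ^ (-((n + 2 : ℕ) : ℝ) - 1 / 2) *
        (v ^ (2 * H)) ^ (-((n + 2 : ℕ) : ℝ) - 1 / 2) * (((u * v) ^ H) ^ (2 * n) *
        (4 * H * ((u * v) ^ (11 * H / 9) * x ^ (-(4 * H / 9)))) ^ 3) := by
        exact mul_le_mul (mul_le_mul (h1 u ε hu hε) (h1 v η hv hη) (by positivity) (by positivity))
          h2 (by positivity) (by positivity)
    _ = (4 * H) ^ 3 * (u ^ (-(4 * H / 3)) * v ^ (-(4 * H / 3)) * x ^ (-(4 * H / 3))) := by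
        rw [← Real.mul_rpow (by positivity) (by positivity), ← Real.mul_rpow hu.le hv.le,
          ← Real.mul_rpow hu.le hv.le, mul_pow (4 * H), mul_pow ((u * v) ^ _), ← Real.rpow_mul hw.le,
          ← Real.rpow_mul_natCast hw.le, ← Real.rpow_mul_natCast hw.le,
          ← Real.rpow_mul_natCast hx.le]
        have h3 : (u * v) ^ (-(4 * H / 3)) =
            (u * v) ^ (2 * H * (-((n + 2 : ℕ) : ℝ) - 1 / 2)) * ((u * v) ^ (H * ((2 * n : ℕ) : ℝ)) *
              (u * v) ^ (11 * H / 9 * ((3 : ℕ) : ℝ))) := by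
          rw [← Real.rpow_add hw, ← Real.rpow_add hw]
          congr 1
          push_cast
          ring
        have h4 : -(4 * H / 3) = -(4 * H / 9) * ((3 : ℕ) : ℝ) := by push_cast; ring
        rw [h3, h4]
        ring

section

variable {Ω : Type*} [MeasurableSpace Ω] {H : ℝ} {B : ℝ≥0 → Ω → ℝ} {P : Measure Ω}

lemma rectIncrement_le_cauchySchwarz (hB : IsFractionalBrownianMotion H B P) (hH : 0 < H)
    {p p' : ℝ × ℝ} {T : ℝ} (hp : p ∈ regionR T) (hp' : p' ∈ regionR T) :
    1 / 2 * rectIncrement (2 * H) (p'.1 - p.1) (p.2 - p.1) (p'.2 - p'.1) ≤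
      ((p.2 - p.1) * (p'.2 - p'.1)) ^ H := by
  have hn : ∀ p ∈ regionR T, ‖fbmIndicator hB p.1.toNNReal p.2.toNNReal‖ = (p.2 - p.1) ^ H := by
    intro p hp
    have h0 : 0 ≤ p.2 - p.1 := sub_nonneg.2 hp.2.1
    rw [← pow_left_inj₀ (norm_nonneg _) (Real.rpow_nonneg h0 _) two_ne_zero,
      norm_fbmIndicator_sq hB hH, Real.coe_toNNReal _ hp.1,
      Real.coe_toNNReal _ (hp.1.trans hp.2.1), abs_of_nonneg h0, ← Real.rpow_mul_natCast h0,
      mul_comm]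
    simp
  rw [← inner_fbmIndicator hB hp.1 (hp.1.trans hp.2.1) hp'.1 (hp'.1.trans hp'.2.1),
    Real.mul_rpow (sub_nonneg.2 hp.2.1) (sub_nonneg.2 hp'.2.1), ← hn p hp, ← hn p' hp']
  exact real_inner_le_norm _ _

/-- The two signs `(-1)^q` cancel and the rectangular increment is nonnegative, so the norm
disappears. The case of equal left ends must be excluded, since there the negative power of `|x|`
has the default value `0`. -/
lemma norm_covKernel_le (hB : IsFractionalBrownianMotion H B P) (hH₁ : 1 / 2 < H) (hH₂ : H < 3 / 4)
    {q : ℕ} (hq : 2 ≤ q) {T ε η : ℝ} (hε : 0 ≤ ε) (hη : 0 ≤ η) {z : (ℝ × ℝ) × (ℝ × ℝ)}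
    (hz : z ∈ regionR T ×ˢ regionR T) (hz0 : z.2.1 - z.1.1 ≠ 0) :
    ‖covKernel H q ε η z‖ ≤ betaConst q ^ 2 * ((4 * H) ^ 3 *
      ((z.1.2 - z.1.1) ^ (-(4 * H / 3)) * (z.2.2 - z.2.1) ^ (-(4 * H / 3)) *
        |z.2.1 - z.1.1| ^ (-(4 * H / 3)))) := by
  obtain ⟨hp, hp'⟩ := hz
  have hH : 0 < H := by linarith
  have hq0 : 2 * q - 1 ≠ 0 := by omega
  have hCS := rectIncrement_le_cauchySchwarz hB hH hp hp'
  have hu := sub_nonneg.2 hp.2.1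
  have hv := sub_nonneg.2 hp'.2.1
  have hcov : covKernel H q ε η z = betaConst q ^ 2 *
      ((ε + (z.1.2 - z.1.1) ^ (2 * H)) ^ (-(q : ℝ) - 1 / 2) *
      (η + (z.2.2 - z.2.1) ^ (2 * H)) ^ (-(q : ℝ) - 1 / 2) *
      (1 / 2 * rectIncrement (2 * H) (z.2.1 - z.1.1) (z.1.2 - z.1.1) (z.2.2 - z.2.1)) ^
        (2 * q - 1)) := by
    have h1 : ((-1 : ℝ) ^ q) * (-1) ^ q = 1 := by
      rw [← mul_pow]; simp
    rw [covKernel, chaosCoeff, chaosCoeff]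
    linear_combination (betaConst q ^ 2 * ((ε + (z.1.2 - z.1.1) ^ (2 * H)) ^ (-(q : ℝ) - 1 / 2) *
      (η + (z.2.2 - z.2.1) ^ (2 * H)) ^ (-(q : ℝ) - 1 / 2) *
      (1 / 2 * rectIncrement (2 * H) (z.2.1 - z.1.1) (z.1.2 - z.1.1) (z.2.2 - z.2.1)) ^
        (2 * q - 1))) * h1
  have hx := abs_pos.2 hz0
  set u := z.1.2 - z.1.1 with hu'
  set v := z.2.2 - z.2.1 with hv'
  set x := z.2.1 - z.1.1 with hx'
  have hm0 : 0 ≤ 1 / 2 * rectIncrement (2 * H) x u v :=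
    mul_nonneg (by norm_num) (rectIncrement_nonneg (by linarith) x hu hv)
  have hnn : 0 ≤ covKernel H q ε η z := by rw [hcov]; positivity
  rw [Real.norm_of_nonneg hnn, hcov]
  refine mul_le_mul_of_nonneg_left ?_ (by positivity)
  -- An interval of length zero has a vanishing increment, which makes the whole kernel zero.
  rcases hu.eq_or_lt with hu0 | hu0
  · have : rectIncrement (2 * H) x u v = 0 := by rw [← hu0, rectIncrement]; simp
    rw [this, mul_zero, zero_pow hq0, mul_zero]
    positivity
  rcases hv.eq_or_lt with hv0 | hv0
  · have : rectIncrement (2 * H) x u v = 0 := by rw [← hv0, rectIncrement]; simp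
    rw [this, mul_zero, zero_pow hq0, mul_zero]
    positivity
  refine rpow_mul_rpow_mul_pow_le hq hu0 hv0 hx hε hη hm0 hCS ?_
  -- The exponents `a = 11H/9`, `b = 4H/9` solve `2a - b = 2H` and `3b = 4H/3`; the condition `a ≤
  -- 1` holds since `H < 3/4 < 9/11`.
  have hprod : ∀ x u v : ℝ, 0 < x → 0 < u → 0 < v → rectIncrement (2 * H) x u v ≤
      4 * (2 * H) * ((u * v) ^ (11 * H / 9) * x ^ (-(4 * H / 9))) := fun x u v hx hu hv =>
    rectIncrement_le_prod (by linarith) (by linarith) (by linarith) (by linarith) (by ring)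
      hx hu hv
  have : rectIncrement (2 * H) x u v ≤
      4 * (2 * H) * ((u * v) ^ (11 * H / 9) * |x| ^ (-(4 * H / 9))) := by
    rcases lt_or_gt_of_ne hz0 with h | h
    · rw [abs_of_neg h, ← rectIncrement_symm, mul_comm u v]
      exact hprod (-x) v u (neg_pos.2 h) hv0 hu0
    · rw [abs_of_pos h]
      exact hprod x u v h hu0 hv0
  linarith

end

/-! ### The integrable dominating function. -/

lemma lintegral_mul_shear {c d : ℝ → ℝ≥0∞} (hc : Measurable c) (hd : Measurable d) (x : ℝ) :
    ∫⁻ p : ℝ × ℝ, c (p.1 - x) * d (p.2 - p.1) = (∫⁻ y, c y) * ∫⁻ y, d y := by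
  rw [Measure.volume_eq_prod, lintegral_prod _ (by fun_prop)]
  simp only
  have : ∀ y : ℝ, ∫⁻ t, c (y - x) * d (t - y) = c (y - x) * ∫⁻ t, d t := by
    intro y
    rw [lintegral_const_mul _ (by fun_prop), lintegral_sub_right_eq_self d]
  simp only [this]
  rw [lintegral_mul_const _ (by fun_prop), lintegral_sub_right_eq_self c]

/-- The variables `s₁`, `t₁ - s₁`, `s₂ - s₁`, `t₂ - s₂` are a shear of the original ones, so by
Tonelli and translation invariance the integral is a product of four one-dimensional ones. -/
lemma integrable_mul_shear {a b c d : ℝ → ℝ} (ha : Measurable a) (hb : Measurable b)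
    (hc : Measurable c) (hd : Measurable d) (ha' : Integrable a) (hb' : Integrable b)
    (hc' : Integrable c) (hd' : Integrable d) :
    Integrable fun z : (ℝ × ℝ) × (ℝ × ℝ) =>
      (a z.1.1 * b (z.1.2 - z.1.1)) * (c (z.2.1 - z.1.1) * d (z.2.2 - z.2.1)) := by
  refine ⟨Measurable.aestronglyMeasurable (by fun_prop), ?_⟩
  rw [hasFiniteIntegral_iff_enorm, Measure.volume_eq_prod, lintegral_prod _ (by fun_prop)]
  simp only [enorm_mul]
  have h1 : ∀ p : ℝ × ℝ, ∫⁻ p' : ℝ × ℝ, (‖a p.1‖ₑ * ‖b (p.2 - p.1)‖ₑ) *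
      (‖c (p'.1 - p.1)‖ₑ * ‖d (p'.2 - p'.1)‖ₑ) =
      (‖a (p.1 - 0)‖ₑ * ‖b (p.2 - p.1)‖ₑ) * ((∫⁻ y, ‖c y‖ₑ) * ∫⁻ y, ‖d y‖ₑ) := by
    intro p
    rw [lintegral_const_mul _ (by fun_prop), sub_zero,
      lintegral_mul_shear (c := fun y => ‖c y‖ₑ) (d := fun y => ‖d y‖ₑ) (by fun_prop) (by fun_prop)]
  simp only [h1]
  rw [lintegral_mul_const _ (by fun_prop),
    lintegral_mul_shear (c := fun y => ‖a y‖ₑ) (d := fun y => ‖b y‖ₑ) (by fun_prop) (by fun_prop)]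
  exact ENNReal.mul_lt_top (ENNReal.mul_lt_top ha'.2 hb'.2) (ENNReal.mul_lt_top hc'.2 hd'.2)

/-- `y ^ r` on `(0, T]`, extended by `0`. -/
def rpowCutoff (T r : ℝ) : ℝ → ℝ := (Set.Ioc 0 T).indicator fun y => y ^ r

lemma measurable_rpowCutoff (T r : ℝ) : Measurable (rpowCutoff T r) :=
  (by fun_prop : Measurable fun y : ℝ => y ^ r).indicator measurableSet_Ioc

lemma integrable_rpowCutoff {T r : ℝ} (hT : 0 ≤ T) (hr : -1 < r) : Integrable (rpowCutoff T r) :=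
  (integrable_indicator_iff measurableSet_Ioc).2
    ((intervalIntegrable_iff_integrableOn_Ioc_of_le hT).1
      (intervalIntegral.intervalIntegrable_rpow' hr))

lemma rpowCutoff_nonneg (T r y : ℝ) : 0 ≤ rpowCutoff T r y :=
  Set.indicator_nonneg (fun _ hy => Real.rpow_nonneg hy.1.le _) y

lemma rpow_le_rpowCutoff {T r y : ℝ} (hr : r ≠ 0) (hy : 0 ≤ y) (hyT : y ≤ T) :
    y ^ r ≤ rpowCutoff T r y := by
  rcases hy.eq_or_lt with rfl | hy
  -- At `y = 0` a nonzero power takes the value `0`, so the bound holds there even for negative `r`.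
  · rw [Real.zero_rpow hr]
    exact rpowCutoff_nonneg _ _ _
  · rw [rpowCutoff, Set.indicator_of_mem (Set.mem_Ioc.2 ⟨hy, hyT⟩)]

lemma abs_rpow_le_rpowCutoff {T r y : ℝ} (hr : r ≠ 0) (hyT : |y| ≤ T) :
    |y| ^ r ≤ rpowCutoff T r y + rpowCutoff T r (-y) := by
  rcases le_total 0 y with h | h
  · rw [abs_of_nonneg h] at hyT ⊢
    linarith [rpow_le_rpowCutoff hr h hyT, rpowCutoff_nonneg T r (-y)]
  · rw [abs_of_nonpos h] at hyT ⊢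
    linarith [rpow_le_rpowCutoff hr (neg_nonneg.2 h) hyT, rpowCutoff_nonneg T r y]

/-- An integrable function dominating all the kernels `covKernel H q ε η` on `𝓡 × 𝓡`. -/
def covBound (H T : ℝ) (q : ℕ) (z : (ℝ × ℝ) × (ℝ × ℝ)) : ℝ :=
  betaConst q ^ 2 * ((4 * H) ^ 3 *
    (((Set.Icc 0 T).indicator 1 z.1.1 * rpowCutoff T (-(4 * H / 3)) (z.1.2 - z.1.1)) *
      ((fun y => rpowCutoff T (-(4 * H / 3)) y + rpowCutoff T (-(4 * H / 3)) (-y))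
        (z.2.1 - z.1.1) * rpowCutoff T (-(4 * H / 3)) (z.2.2 - z.2.1))))

/-- Here `H < 3/4` enters as `-4H/3 > -1`. The factor in `s₂ - s₁` is symmetrised because this
difference has either sign. -/
lemma integrable_covBound {H T : ℝ} (hH : H < 3 / 4) (hT : 0 ≤ T) (q : ℕ) :
    Integrable (covBound H T q) := by
  have hm := measurable_rpowCutoff T (-(4 * H / 3))
  have hi := integrable_rpowCutoff hT (by linarith : -1 < -(4 * H / 3))
  refine ((integrable_mul_shear (measurable_const.indicator measurableSet_Icc) hm
    (hm.add (hm.comp measurable_neg)) hm ?_ hi (hi.add hi.comp_neg) hi).const_mul _).const_mul _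
  exact (integrable_indicator_iff measurableSet_Icc).2
    (integrableOn_const (by simp) (by simp))

lemma ae_sub_ne_zero : ∀ᵐ z : (ℝ × ℝ) × (ℝ × ℝ), z.2.1 - z.1.1 ≠ 0 := by
  have h := (quasiMeasurePreserving_sub (volume : Measure ℝ) volume).comp
    (QuasiMeasurePreserving.prodMap
      (Measure.quasiMeasurePreserving_fst (μ := (volume : Measure ℝ)) (ν := (volume : Measure ℝ)))
      (Measure.quasiMeasurePreserving_fst (μ := (volume : Measure ℝ)) (ν := (volume : Measure ℝ))))
  have h0 : ∀ᵐ y : ℝ, -y ≠ 0 := by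
    filter_upwards [compl_mem_ae_iff.2 (measure_singleton (0 : ℝ))] with y hy
    exact neg_ne_zero.2 hy
  filter_upwards [h.ae h0] with z hz
  simpa using hz

section

variable {Ω : Type*} [MeasurableSpace Ω] {H : ℝ} {B : ℝ≥0 → Ω → ℝ} {P : Measure Ω}

lemma norm_covKernel_le_covBound (hB : IsFractionalBrownianMotion H B P) (hH₁ : 1 / 2 < H)
    (hH₂ : H < 3 / 4) {q : ℕ} (hq : 2 ≤ q) {T ε η : ℝ} (hε : 0 ≤ ε) (hη : 0 ≤ η)
    {z : (ℝ × ℝ) × (ℝ × ℝ)} (hz : z ∈ regionR T ×ˢ regionR T) (hz0 : z.2.1 - z.1.1 ≠ 0) :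
    ‖covKernel H q ε η z‖ ≤ covBound H T q z := by
  refine (norm_covKernel_le hB hH₁ hH₂ hq hε hη hz hz0).trans ?_
  obtain ⟨⟨h1, h2, h3⟩, h4, h5, h6⟩ := hz
  have hr : -(4 * H / 3) ≠ 0 := by linarith
  have hmem : z.1.1 ∈ Set.Icc 0 T := ⟨h1, h2.trans h3⟩
  rw [covBound, Set.indicator_of_mem hmem, Pi.one_apply, one_mul]
  have e1 := rpow_le_rpowCutoff hr (sub_nonneg.2 h2) (by linarith : z.1.2 - z.1.1 ≤ T)
  have e2 := rpow_le_rpowCutoff hr (sub_nonneg.2 h5) (by linarith : z.2.2 - z.2.1 ≤ T)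
  have e3 := abs_rpow_le_rpowCutoff hr
    (abs_le.2 ⟨by linarith, by linarith⟩ : |z.2.1 - z.1.1| ≤ T)
  have hu := sub_nonneg.2 h2
  have hv := sub_nonneg.2 h5
  have n1 := rpowCutoff_nonneg T (-(4 * H / 3)) (z.1.2 - z.1.1)
  have hH : 0 ≤ H := by linarith
  refine mul_le_mul_of_nonneg_left (mul_le_mul_of_nonneg_left ?_ (by positivity)) (by positivity)
  rw [mul_assoc, mul_comm ((z.2.2 - z.2.1) ^ _)]
  gcongr
  exact add_nonneg (rpowCutoff_nonneg _ _ _) (rpowCutoff_nonneg _ _ _)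

/-! ### Passage to the limit in the covariances. -/

lemma tendsto_chaosCoeff (H : ℝ) (q : ℕ) {p : ℝ × ℝ} (hp : p.1 < p.2) :
    Tendsto (fun ε => chaosCoeff H q ε p) (𝓝[>] 0) (𝓝 (chaosCoeff H q 0 p)) := by
  have hw : 0 < (p.2 - p.1) ^ (2 * H) := Real.rpow_pos_of_pos (sub_pos.2 hp) _
  have h : ContinuousAt (fun ε => chaosCoeff H q ε p) 0 := by
    refine continuousAt_const.mul (ContinuousAt.rpow_const (by fun_prop) (Or.inl ?_))
    rw [zero_add]
    exact hw.ne'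
  exact h.tendsto.mono_left nhdsWithin_le_nhds

/-- Off the diagonals the coefficients are continuous at `0`. On a diagonal they are singular, but
the increment is zero, so the kernel vanishes for all `ε`, `η`. -/
lemma tendsto_covKernel (H : ℝ) {q : ℕ} (hq : 1 ≤ q) {T : ℝ} {z : (ℝ × ℝ) × (ℝ × ℝ)}
    (hz : z ∈ regionR T ×ˢ regionR T) :
    Tendsto (fun e : ℝ × ℝ => covKernel H q e.1 e.2 z) (𝓝[>] 0 ×ˢ 𝓝[>] 0)
      (𝓝 (covKernel H q 0 0 z)) := by
  have hq0 : 2 * q - 1 ≠ 0 := by omega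
  rcases hz.1.2.1.eq_or_lt with h1 | h1
  · have : ∀ ε η, covKernel H q ε η z = 0 := fun ε η => by
      rw [covKernel, h1, rectIncrement]; simp [hq0]
    simp [this]
  rcases hz.2.2.1.eq_or_lt with h2 | h2
  · have : ∀ ε η, covKernel H q ε η z = 0 := fun ε η => by
      rw [covKernel, h2, rectIncrement]; simp [hq0]
    simp [this]
  exact (((tendsto_chaosCoeff H q h1).comp tendsto_fst).mul
    ((tendsto_chaosCoeff H q h2).comp tendsto_snd)).mul_const _

lemma measurable_chaosCoeff (H : ℝ) (q : ℕ) (ε : ℝ) : Measurable (chaosCoeff H q ε) := by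
  unfold chaosCoeff
  fun_prop

lemma measurable_covKernel (hH : 0 < H) (q : ℕ) (ε η : ℝ) : Measurable (covKernel H q ε η) := by
  refine (((measurable_chaosCoeff H q ε).comp measurable_fst).mul
    ((measurable_chaosCoeff H q η).comp measurable_snd)).mul (Continuous.measurable ?_)
  refine (continuous_const.mul (continuous_rectIncrement ?_ ?_ ?_ ?_)).pow _
  · linarith
  all_goals fun_prop

lemma ae_norm_covKernel_le (hB : IsFractionalBrownianMotion H B P) (hH₁ : 1 / 2 < H)
    (hH₂ : H < 3 / 4) {q : ℕ} (hq : 2 ≤ q) (T : ℝ) {ε η : ℝ} (hε : 0 ≤ ε) (hη : 0 ≤ η) :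
    ∀ᵐ z ∂(volume.restrict (regionR T ×ˢ regionR T)),
      ‖covKernel H q ε η z‖ ≤ covBound H T q z := by
  have hm := (isCompact_regionR T).measurableSet
  filter_upwards [ae_restrict_mem (hm.prod hm), ae_restrict_of_ae ae_sub_ne_zero] with z hz hz0
  exact norm_covKernel_le_covBound hB hH₁ hH₂ hq hε hη hz hz0

lemma integrableOn_covKernel_zero (hB : IsFractionalBrownianMotion H B P) (hH₁ : 1 / 2 < H)
    (hH₂ : H < 3 / 4) {q : ℕ} (hq : 2 ≤ q) {T : ℝ} (hT : 0 ≤ T) :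
    IntegrableOn (covKernel H q 0 0) (regionR T ×ˢ regionR T) :=
  (integrable_covBound hH₂ hT q).integrableOn.mono'
    (measurable_covKernel (by linarith) q 0 0).aestronglyMeasurable
    (ae_norm_covKernel_le hB hH₁ hH₂ hq T le_rfl le_rfl)

/-- Dominated convergence with `covBound`, which does not depend on the levels. The two levels tend
to `0` independently, as the Cauchy argument requires. -/
lemma tendsto_integral_covKernel (hB : IsFractionalBrownianMotion H B P) (hH₁ : 1 / 2 < H)
    (hH₂ : H < 3 / 4) {q : ℕ} (hq : 2 ≤ q) {T : ℝ} (hT : 0 ≤ T) :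
    Tendsto (fun e : ℝ × ℝ => ∫ z in regionR T ×ˢ regionR T, covKernel H q e.1 e.2 z)
      (𝓝[>] 0 ×ˢ 𝓝[>] 0) (𝓝 (∫ z in regionR T ×ˢ regionR T, covKernel H q 0 0 z)) := by
  have hm := (isCompact_regionR T).measurableSet
  have hpos : ∀ᶠ e : ℝ × ℝ in 𝓝[>] 0 ×ˢ 𝓝[>] 0, 0 < e.1 ∧ 0 < e.2 :=
    (eventually_mem_nhdsWithin (a := (0 : ℝ)) (s := Set.Ioi 0)).prod_mk
      (eventually_mem_nhdsWithin (a := (0 : ℝ)) (s := Set.Ioi 0))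
  refine tendsto_integral_filter_of_dominated_convergence (covBound H T q) ?_ ?_
    (integrable_covBound hH₂ hT q).integrableOn ?_
  · exact Eventually.of_forall fun e =>
      (measurable_covKernel (by linarith) q e.1 e.2).aestronglyMeasurable
  · filter_upwards [hpos] with e he
    exact ae_norm_covKernel_le hB hH₁ hH₂ hq T he.1.le he.2.le
  · filter_upwards [ae_restrict_mem (hm.prod hm)] with z hz
    exact tendsto_covKernel H (by omega) hz

end

/-! ### The region `𝓢` -/

/-- The reordering `(s₁, s₂, t₁, t₂) ↦ ((s₁, t₁), (s₂, t₂))`. -/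
def reorderEquiv : ℝ × ℝ × ℝ × ℝ ≃ᵐ (ℝ × ℝ) × (ℝ × ℝ) :=
  ((MeasurableEquiv.refl ℝ).prodCongr (MeasurableEquiv.prodAssoc.symm.trans
    ((MeasurableEquiv.prodComm.prodCongr (MeasurableEquiv.refl ℝ)).trans
      MeasurableEquiv.prodAssoc))).trans MeasurableEquiv.prodAssoc.symm

lemma reorderEquiv_apply (p : ℝ × ℝ × ℝ × ℝ) :
    reorderEquiv p = ((p.1, p.2.2.1), (p.2.1, p.2.2.2)) := rfl

lemma measurePreserving_reorderEquiv : MeasurePreserving reorderEquiv := by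
  have h1 : MeasurePreserving (MeasurableEquiv.prodAssoc (α := ℝ) (β := ℝ) (γ := ℝ)) :=
    volume_preserving_prodAssoc
  have h2 : MeasurePreserving (MeasurableEquiv.prodAssoc (α := ℝ) (β := ℝ) (γ := ℝ × ℝ)) :=
    volume_preserving_prodAssoc
  have h3 : MeasurePreserving (Prod.swap : ℝ × ℝ → ℝ × ℝ) := Measure.measurePreserving_swap
  exact (h2.symm _).comp ((MeasurePreserving.id volume).prod
    ((h1.comp (h3.prod (MeasurePreserving.id volume))).comp (h1.symm _)))

/-- The part of `𝓡 × 𝓡` where `s₁ ≤ s₂`. -/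
def orderedPairs (T : ℝ) : Set ((ℝ × ℝ) × (ℝ × ℝ)) :=
  (regionR T ×ˢ regionR T) ∩ {z | z.1.1 ≤ z.2.1}

lemma measurableSet_orderedPairs (T : ℝ) : MeasurableSet (orderedPairs T) :=
  have hm := (isCompact_regionR T).measurableSet
  (hm.prod hm).inter (measurableSet_le (by fun_prop) (by fun_prop))

lemma preimage_reorderEquiv_orderedPairs (T : ℝ) :
    reorderEquiv ⁻¹' orderedPairs T = regionS T := by
  ext p
  simp only [Set.mem_preimage, reorderEquiv_apply, orderedPairs, regionR, regionS, Set.mem_inter_iff,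
    Set.mem_prod, Set.mem_ofPred_eq, Set.mem_Icc]
  constructor
  · rintro ⟨⟨⟨h1, h2, h3⟩, h4, h5, h6⟩, h7⟩
    refine ⟨⟨h1, ?_⟩, ⟨h4, ?_⟩, ⟨?_, h3⟩, ⟨?_, h6⟩, h2, h5, h7⟩ <;> linarith
  · rintro ⟨⟨h1, h2⟩, ⟨h3, h4⟩, ⟨h5, h6⟩, ⟨h7, h8⟩, h9, h10, h11⟩
    exact ⟨⟨⟨h1, h9, h6⟩, h3, h10, h8⟩, h11⟩

lemma covKernel_swap (H : ℝ) (q : ℕ) (ε : ℝ) (z : (ℝ × ℝ) × (ℝ × ℝ)) :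
    covKernel H q ε ε z.swap = covKernel H q ε ε z := by
  rw [covKernel, covKernel, Prod.fst_swap, Prod.snd_swap, ← neg_sub z.2.1 z.1.1,
    rectIncrement_symm, mul_comm (chaosCoeff H q ε z.2)]

/-- The two halves `s₁ ≤ s₂` and `s₂ ≤ s₁` are exchanged by a measure-preserving swap under which
the kernel is invariant, and they overlap in a null set. This is the factor `2` in the limiting
variance. -/
lemma setIntegral_covKernel_eq_two_mul {H T : ℝ} {q : ℕ} {ε : ℝ}
    (hi : IntegrableOn (covKernel H q ε ε) (regionR T ×ˢ regionR T)) :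
    ∫ z in regionR T ×ˢ regionR T, covKernel H q ε ε z =
      2 * ∫ z in orderedPairs T, covKernel H q ε ε z := by
  have hswap : MeasurePreserving (Prod.swap : (ℝ × ℝ) × (ℝ × ℝ) → (ℝ × ℝ) × (ℝ × ℝ)) :=
    Measure.measurePreserving_swap
  have hunion : regionR T ×ˢ regionR T = orderedPairs T ∪ Prod.swap ⁻¹' orderedPairs T := by
    ext z
    simp only [orderedPairs, Set.mem_union, Set.mem_inter_iff, Set.mem_preimage, Set.mem_prod,
      Set.mem_ofPred_eq, Prod.fst_swap, Prod.snd_swap]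
    have := le_total z.1.1 z.2.1
    tauto
  have hm := measurableSet_orderedPairs T
  have hdisj : AEDisjoint volume (orderedPairs T) (Prod.swap ⁻¹' orderedPairs T) := by
    refine measure_mono_null ?_ (ae_iff.1 ae_sub_ne_zero)
    rintro z ⟨⟨_, h1⟩, _, h2⟩
    simp only [Set.mem_ofPred_eq, Prod.fst_swap, Prod.snd_swap] at h1 h2 ⊢
    rw [not_not, sub_eq_zero]
    exact le_antisymm h2 h1
  have h2 : ∫ z in Prod.swap ⁻¹' orderedPairs T, covKernel H q ε ε z =
      ∫ z in orderedPairs T, covKernel H q ε ε z := by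
    rw [← hswap.setIntegral_preimage_emb MeasurableEquiv.prodComm.measurableEmbedding _
      (orderedPairs T)]
    simp only [covKernel_swap]
  rw [hunion] at hi ⊢
  rw [setIntegral_union₀ hdisj (hm.preimage measurable_swap).nullMeasurableSet
    (hi.mono_set Set.subset_union_left) (hi.mono_set Set.subset_union_right), h2, two_mul]

section

variable {Ω : Type*} [MeasurableSpace Ω] {H : ℝ} {B : ℝ≥0 → Ω → ℝ} {P : Measure Ω}

/-- The sign `(-1)^q` occurs twice and disappears. The ordering `s₁ ≤ s₂` in `𝓢` keeps the first
argument of `μ` nonnegative, where its covariance formula is valid. -/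
lemma covKernel_zero_reorderEquiv (hB : IsFractionalBrownianMotion H B P) (q : ℕ) {T : ℝ}
    {p : ℝ × ℝ × ℝ × ℝ} (hp : p ∈ regionS T) :
    covKernel H q 0 0 (reorderEquiv p) = betaConst q ^ 2 * limitIntegrand H B P q p := by
  obtain ⟨h1, h2, h3, h4, h5, h6, h7⟩ := hp
  rw [limitIntegrand, GKernel, hB.muCov_eq (sub_nonneg.2 h7) (sub_nonneg.2 h5) (sub_nonneg.2 h6),
    covKernel, chaosCoeff, chaosCoeff, reorderEquiv_apply]
  simp only
  rw [show -(1 / 2) - (q : ℝ) = -(q : ℝ) - 1 / 2 by ring]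
  have h1 : ((-1 : ℝ) ^ q) * (-1) ^ q = 1 := by
    rw [← mul_pow]; simp
  linear_combination (betaConst q ^ 2 * ((0 + (p.2.2.1 - p.1) ^ (2 * H)) ^ (-(q : ℝ) - 1 / 2) *
    (0 + (p.2.2.2 - p.2.1) ^ (2 * H)) ^ (-(q : ℝ) - 1 / 2) *
    (1 / 2 * rectIncrement (2 * H) (p.2.1 - p.1) (p.2.2.1 - p.1) (p.2.2.2 - p.2.1)) ^
      (2 * q - 1))) * h1

lemma measurableSet_regionS (T : ℝ) : MeasurableSet (regionS T) := by
  rw [← preimage_reorderEquiv_orderedPairs]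
  exact (measurableSet_orderedPairs T).preimage reorderEquiv.measurable

lemma betaConst_pos (q : ℕ) : 0 < betaConst q := by
  have := Real.sqrt_pos.2 Real.pi_pos
  rw [betaConst]
  positivity

lemma integrableOn_limitIntegrand (hB : IsFractionalBrownianMotion H B P) (hH₁ : 1 / 2 < H)
    (hH₂ : H < 3 / 4) {q : ℕ} (hq : 2 ≤ q) {T : ℝ} (hT : 0 ≤ T) :
    IntegrableOn (limitIntegrand H B P q) (regionS T) := by
  have h1 : IntegrableOn (covKernel H q 0 0) (orderedPairs T) :=
    (integrableOn_covKernel_zero hB hH₁ hH₂ hq hT).mono_set Set.inter_subset_left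
  rw [← measurePreserving_reorderEquiv.integrableOn_comp_preimage
    reorderEquiv.measurableEmbedding, preimage_reorderEquiv_orderedPairs] at h1
  have hβ := (betaConst_pos q).ne'
  refine IntegrableOn.congr_fun (h1.const_mul (betaConst q ^ 2)⁻¹) (fun p hp => ?_)
    (measurableSet_regionS T)
  simp only [Function.comp_apply]
  rw [covKernel_zero_reorderEquiv hB q hp]
  field_simp

lemma limitVariance_eq (hB : IsFractionalBrownianMotion H B P) (hH₁ : 1 / 2 < H)
    (hH₂ : H < 3 / 4) {q : ℕ} (hq : 2 ≤ q) {T : ℝ} (hT : 0 ≤ T) :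
    limitVariance H B P T q =
      ((2 * q - 1).factorial : ℝ) * ∫ z in regionR T ×ˢ regionR T, covKernel H q 0 0 z := by
  rw [setIntegral_covKernel_eq_two_mul (integrableOn_covKernel_zero hB hH₁ hH₂ hq hT),
    ← measurePreserving_reorderEquiv.setIntegral_preimage_emb reorderEquiv.measurableEmbedding,
    preimage_reorderEquiv_orderedPairs,
    setIntegral_congr_fun (measurableSet_regionS T)
      (fun p hp => covKernel_zero_reorderEquiv hB q hp), integral_const_mul, limitVariance]
  ring

/-! ### Convergence in `L²` -/

lemma tendsto_inner_self_of_tendsto_inner {ι E : Type*} [NormedAddCommGroup E]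
    [InnerProductSpace ℝ E] {f : ι → E} {l : Filter ι} {L : ℝ}
    (h : Tendsto (fun p : ι × ι => inner ℝ (f p.1) (f p.2)) (l ×ˢ l) (𝓝 L)) :
    Tendsto (fun i => inner ℝ (f i) (f i)) l (𝓝 L) :=
  h.comp tendsto_diag

/-- The three terms of `‖f i - f j‖²` converge to `L`, `2L` and `L`, so the family is Cauchy. -/
lemma exists_tendsto_of_tendsto_inner {ι E : Type*} [NormedAddCommGroup E] [InnerProductSpace ℝ E]
    [CompleteSpace E] {f : ι → E} {l : Filter ι} [l.NeBot] {L : ℝ}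
    (h : Tendsto (fun p : ι × ι => inner ℝ (f p.1) (f p.2)) (l ×ˢ l) (𝓝 L)) :
    ∃ F, Tendsto f l (𝓝 F) := by
  rw [← cauchy_map_iff_exists_tendsto, cauchy_map_iff]
  refine ⟨inferInstance, tendsto_uniformity_iff_dist_tendsto_zero.2 ?_⟩
  have h1 := h.comp (tendsto_fst.prodMk tendsto_fst : Tendsto (fun p : ι × ι => (p.1, p.1))
    (l ×ˢ l) (l ×ˢ l))
  have h2 := h.comp (tendsto_snd.prodMk tendsto_snd : Tendsto (fun p : ι × ι => (p.2, p.2))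
    (l ×ˢ l) (l ×ˢ l))
  have h3 := (((h1.sub (h.const_mul 2)).add h2).sqrt)
  rw [show √(L - 2 * L + L) = 0 by rw [Real.sqrt_eq_zero']; linarith] at h3
  refine h3.congr fun p => ?_
  simp only [Function.comp_apply]
  rw [real_inner_self_eq_norm_sq, real_inner_self_eq_norm_sq, ← norm_sub_sq_real,
    Real.sqrt_sq (norm_nonneg _), dist_eq_norm]

/-- A chaos of positive order is orthogonal to the constants: the case `ρ = 0` of
`integral_hermiteReal_add` gives `H_m` Gaussian mean zero, and orthogonality passes to the closed
span. -/
lemma integral_eq_zero_of_mem_wienerChaos (hB : IsFractionalBrownianMotion H B P) {m : ℕ}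
    (hm : m ≠ 0) {X : Lp ℝ 2 P} (hX : X ∈ wienerChaos hB m) : ∫ ω, X ω ∂P = 0 := by
  have := isProbabilityMeasure_of_fbm hB
  set e : Lp ℝ 2 P := (memLp_const (1 : ℝ)).toLp _ with he
  have hint : ∀ Y : Lp ℝ 2 P, inner ℝ e Y = ∫ ω, Y ω ∂P := by
    intro Y
    rw [inner_L2_eq]
    refine integral_congr_ae ?_
    filter_upwards [(memLp_const (μ := P) (p := 2) (1 : ℝ)).coeFn_toLp] with ω hω
    rw [he, hω, one_mul]
  have hle : wienerChaos hB m ≤ (ℝ ∙ e)ᗮ := by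
    refine Submodule.topologicalClosure_minimal _ (Submodule.span_le.2 ?_)
      (Submodule.isClosed_orthogonal _)
    rintro _ ⟨h, hh, rfl⟩
    rw [SetLike.mem_coe, Submodule.mem_orthogonal_singleton_iff_inner_right, hint, hermiteL2,
      integral_congr_ae (memLp_hermite hB m h).coeFn_toLp]
    have h1 := integral_map (f := fun x : ℝ => (hermiteReal m).eval x)
      (Lp.aestronglyMeasurable (fbmIntegral hB h)).aemeasurable (by fun_prop)
    have h2 := integral_hermiteReal_add 0 1 (by simp) m 0
    simp only [zero_mul, zero_add, zero_pow hm] at h2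
    have hn : ‖h‖₊ ^ 2 = 1 := NNReal.eq (by simp [hh])
    rw [map_fbmIntegral, hn, h2] at h1
    exact h1.symm
  rw [← hint]
  exact Submodule.mem_orthogonal_singleton_iff_inner_right.1 (hle hX)

lemma tendsto_inner_chaosComponent (hB : IsFractionalBrownianMotion H B P) (hH₁ : 1 / 2 < H)
    (hH₂ : H < 3 / 4) {q : ℕ} (hq : 2 ≤ q) {T : ℝ} (hT : 0 ≤ T) :
    Tendsto (fun e : ℝ × ℝ => inner ℝ (chaosComponent hB T q e.1) (chaosComponent hB T q e.2))
      (𝓝[>] 0 ×ˢ 𝓝[>] 0) (𝓝 (limitVariance H B P T q)) := by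
  rw [limitVariance_eq hB hH₁ hH₂ hq hT]
  refine ((tendsto_integral_covKernel hB hH₁ hH₂ hq hT).const_mul _).congr' ?_
  filter_upwards [(eventually_mem_nhdsWithin (a := (0 : ℝ)) (s := Set.Ioi 0)).prod_mk
      (eventually_mem_nhdsWithin (a := (0 : ℝ)) (s := Set.Ioi 0))] with e he
  rw [inner_chaosComponent hB (by linarith) T q he.1 he.2]

lemma integral_sq_eq_inner (X : Lp ℝ 2 P) : ∫ ω, (X ω) ^ 2 ∂P = inner ℝ X X := by
  rw [inner_L2_eq]
  simp only [sq]

lemma tendsto_inner_self_chaosComponent (hB : IsFractionalBrownianMotion H B P) (hH₁ : 1 / 2 < H)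
    (hH₂ : H < 3 / 4) {q : ℕ} (hq : 2 ≤ q) {T : ℝ} (hT : 0 ≤ T) :
    Tendsto (fun ε => inner ℝ (chaosComponent hB T q ε) (chaosComponent hB T q ε))
      (𝓝[>] 0) (𝓝 (limitVariance H B P T q)) :=
  tendsto_inner_self_of_tendsto_inner (tendsto_inner_chaosComponent hB hH₁ hH₂ hq hT)

lemma exists_tendsto_chaosComponent (hB : IsFractionalBrownianMotion H B P) (hH₁ : 1 / 2 < H)
    (hH₂ : H < 3 / 4) {q : ℕ} (hq : 2 ≤ q) {T : ℝ} (hT : 0 ≤ T) :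
    ∃ F : Lp ℝ 2 P, Tendsto (fun ε => chaosComponent hB T q ε) (𝓝[>] 0) (𝓝 F) ∧
      Var[F; P] = limitVariance H B P T q := by
  have hq0 : 2 * q - 1 ≠ 0 := by omega
  obtain ⟨F, hF⟩ :=
    exists_tendsto_of_tendsto_inner (tendsto_inner_chaosComponent hB hH₁ hH₂ hq hT)
  refine ⟨F, hF, ?_⟩
  -- The limit stays in the closed chaos, hence is centred, and its variance is the limit of the
  -- second moments.
  have hmem : F ∈ wienerChaos hB (2 * q - 1) :=
    (Submodule.isClosed_topologicalClosure _).mem_of_tendsto hF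
      (Eventually.of_forall fun ε => multipleIntegral_mem_wienerChaos hB hq0 _)
  rw [variance_of_integral_eq_zero (Lp.aestronglyMeasurable F).aemeasurable
    (integral_eq_zero_of_mem_wienerChaos hB hq0 hmem), integral_sq_eq_inner]
  exact tendsto_nhds_unique (hF.inner hF)
    (tendsto_inner_self_chaosComponent hB hH₁ hH₂ hq hT)

end

end

/-- For `q ≥ 2` and `2/3 < H < 3/4`, the `(2q-1)`-th chaotic component of `α_ε` converges in `L²`
as `ε → 0`, and the limiting variance is a finite constant. -/
theorem mainTheorem3 {Ω : Type*} [MeasurableSpace Ω] {P : Measure Ω} {B : ℝ≥0 → Ω → ℝ} {H : ℝ}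
    (hB : IsFractionalBrownianMotion H B P) (hH₁ : 2 / 3 < H) (hH₂ : H < 3 / 4)
    {T : ℝ} (hT : 0 < T) {q : ℕ} (hq : 2 ≤ q) :
    (∀ ε > 0, IntegrableOn (fun p : ℝ × ℝ => chaosKernelAt hB q ε p.1 p.2) (regionR T)) ∧
    (∀ ε > 0,
      AEStronglyMeasurable (fun p : ℝ × Ω => B p.1.toNNReal p.2)
        ((volume.restrict (Set.Icc 0 T)).prod P) →
      ∃ hα : MemLp (alphaEps B T ε) 2 P,
        (wienerChaos hB (2 * q - 1)).starProjection (hα.toLp _) = chaosComponent hB T q ε) ∧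
    IntegrableOn (limitIntegrand H B P q) (regionS T) ∧
    Tendsto (fun ε => ∫ ω, (chaosComponent hB T q ε ω) ^ 2 ∂P) (𝓝[>] 0)
      (𝓝 (limitVariance H B P T q)) ∧
    ∃ F : Lp ℝ 2 P,
      Tendsto (fun ε => chaosComponent hB T q ε) (𝓝[>] 0) (𝓝 F) ∧
      Var[F; P] = limitVariance H B P T q := by
  have hH : 0 < H := by linarith
  have hH' : 1 / 2 < H := by linarith
  refine ⟨fun ε hε => integrableOn_chaosKernelAt hB hH T q hε,
    fun ε hε hmeas => starProjection_alphaEps hB hH hT.le (by omega) hε hmeas,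
    integrableOn_limitIntegrand hB hH' hH₂ hq hT.le, ?_,
    exists_tendsto_chaosComponent hB hH' hH₂ hq hT.le⟩
  simpa only [integral_sq_eq_inner] using
    tendsto_inner_self_chaosComponent hB hH' hH₂ hq hT.le
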